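/- Let $\mathbb T=\mathbb R/\mathbb Z$ (identified with $[0,1]$) and $\mathcal Y=[0,1)$; let $P\in\mathbb R$ and let $V:\mathbb T\times\mathbb R\to\mathbb R$, $(x,y)\mapsto V(x,y)$, be smooth and $1$-periodic in $y$. Let $\epsilon$ run through a sequence of positive numbers converging to $0$, and for each such $\epsilon$ let $(u_\epsilon,m_\epsilon,\overline H_\epsilon)\in C^\infty(\mathbb T)\times C^\infty(\mathbb T)\times\mathbb R$, with $m_\epsilon>0$, solve on $[0,1]$ $$\frac{(P+(u_\epsilon)_x)^2}{2}+V\Big(x,\frac x\epsilon\Big)=\ln m_\epsilon+\overline H_\epsilon,\qquad -\big(m_\epsilon(P+(u_\epsilon)_x)\big)_x=0,\qquad \int_0^1u_\epsilon\,dx=0,\quad \int_0^1 m_\epsilon\,dx=1 .$$ Set $j_\epsilon=m_\epsilon(P+(u_\epsilon)_x)$, which is constant in $x$. A sequence $(w_\epsilon)$ in $L^q(\mathbb T)$ weakly two-scale converges to $w\in L^q(\mathbb T\times\mathcal Y)$ if $\int_0^1w_\epsilon(x)\psi(x,x/\epsilon)\,dx\to\int_0^1\int_0^1 w(x,y)\psi(x,y)\,dy\,dx$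 for every smooth $\psi$ on $\mathbb R^2$ that is $1$-periodic in each variable; it strongly two-scale converges to $w$ if moreover $\|w_\epsilon\|_{L^q(\mathbb T)}\to\|w\|_{L^q(\mathbb T\times\mathcal Y)}$. Fix $q\in[1,\infty)$. Let $W^{1,q}_\#(\mathcal Y)$ be the $1$-periodic functions in $W^{1,q}$. Then $(m_\epsilon)_\epsilon$ is uniformly bounded in $L^\infty(\mathbb T)$, and there are a subsequence of $\epsilon$ and limits $u_0\in C^{0,\alpha}(\mathbb T)\cap W^{1,q}(\mathbb T)$ for some $\alpha\in(0,1)$, with $\int_0^1u_0\,dx=0$, $u_1\in L^q(\mathbb T;W^{1,q}_\#(\mathcal Y)/\mathbb R)$, $m\in L^1(\mathbb T\times\mathcal Y)$ with $\int_0^1\int_0^1 m\,dy\,dx=1$, and $\overline H,j\in\mathbb R$ such that, along the subsequence, $$(\ast)\quad\begin{aligned}&u_\epsilon\to u_0\text{ in }L^\infty(\mathbb T)\text{ and weakly in }W^{1,q}(\mathbb T),\quad (u_\epsilon)_x\text{ weakly two-scale converges to }(u_0)_x+(u_1)_y\text{ in }L^q(\mathbb T\times\mathcal Y),\\ &m_\epsilon\text{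 weakly two-scale converges to }m\text{ in }L^1(\mathbb T\times\mathcal Y),\quad m_\epsilon\rightharpoonup\int_{\mathcal Y}m(\cdot,y)\,dy\text{ in }L^1(\mathbb T),\quad \overline H_\epsilon\to\overline H,\quad j_\epsilon\to j.\end{aligned}$$ Moreover, whenever $(u_0,u_1,m,\overline H,j)$, in these spaces and with these normalizations, satisfies $(\ast)$ along some subsequence, the following holds. Let $F(t)=\frac{j^2}{2t^2}-\ln t$ for $t>0$, a decreasing bijection of $(0,\infty)$ onto $\mathbb R$. For almost every $(x,y)\in\mathbb T\times\mathcal Y$, $$m(x,y)=F^{-1}\big(\overline H-V(x,y)\big)>0,$$ and, along that subsequence, $m_\epsilon$ strongly two-scale converges to $m$ in $L^p(\mathbb T\times\mathcal Y)$ for all $p\in(1,\infty)$. Furthermore, $1/m$ is integrable on $\mathbb T\times\mathcal Y$, $$j=\frac{P}{\int_0^1\int_0^1\frac1{m(x,y)}\,dy\,dx},$$ $$u_0(x)=\int_0^x\int_0^1\frac{j}{m(s,y)}\,dy\,ds-Px+\frac P2-\int_0^1\int_0^z\int_0^1\frac{j}{m(s,y)}\,dy\,ds\,dz\qquad(x\in[0,1]),$$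 and, for almost every $x\in\mathbb T$, with $u_1(x,\cdot)$ denoting its continuous $1$-periodic representative, $$u_1(x,y)=u_1(x,0)+\int_0^y\frac{j}{m(x,s)}\,ds-y\int_0^1\frac{j}{m(x,z)}\,dz\qquad(y\in[0,1]).$$ -/

import Mathlib

open Set Filter Topology MeasureTheory
open scoped ENNReal NNReal ContDiff

noncomputable section

namespace PeriodicMFG

/-! Functions on the torus `ℝ/ℤ`, and `𝒴`-periodic functions, are `1`-periodic functions on `ℝ`;
`Lᵖ` classes on the torus (or on the cell `𝒴`) are functions on `ℝ` seen through the following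
measure. -/

/-- Lebesgue measure on the unit cell. -/
def cell : Measure ℝ := volume.restrict (Ioc (0 : ℝ) 1)

/-- Lebesgue measure on `𝕋 × 𝒴`. -/
def cell2 : Measure (ℝ × ℝ) := cell.prod cell

/-- `u ∈ C^∞(𝕋)`; also `u ∈ C^∞_#(𝒴)`. -/
def SmoothPeriodic (u : ℝ → ℝ) : Prop :=
  ContDiff ℝ ∞ u ∧ Function.Periodic u 1

/-- `ψ ∈ C^∞(𝕋; C^∞_#(𝒴))`: jointly smooth, and `1`-periodic in each variable. -/
def SmoothPeriodic2 (ψ : ℝ → ℝ → ℝ) : Prop :=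
  ContDiff ℝ ∞ (fun z : ℝ × ℝ => ψ z.1 z.2) ∧
    (∀ x y, ψ (x + 1) y = ψ x y) ∧ (∀ x y, ψ x (y + 1) = ψ x y)

/-- The one-dimensional stationary mean-field game with potential `V(x, x/ε)`; the torus is
identified with `[0,1]`. -/
structure IsMFGSolution (P : ℝ) (V : ℝ → ℝ → ℝ) (ε : ℝ) (u m : ℝ → ℝ) (H : ℝ) : Prop where
  smooth_u : SmoothPeriodic u
  smooth_m : SmoothPeriodic m
  m_pos : ∀ x, 0 < m x
  hamilton_jacobi : ∀ x ∈ Icc (0 : ℝ) 1,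
    (P + deriv u x) ^ 2 / 2 + V x (x / ε) = Real.log (m x) + H
  fokker_planck : ∀ x ∈ Icc (0 : ℝ) 1, -deriv (fun s => m s * (P + deriv u s)) x = 0
  mean_u : ∫ x in (0 : ℝ)..1, u x = 0
  mass_m : ∫ x in (0 : ℝ)..1, m x = 1

/-- The current `m (P + u_x)` (a constant function when `(u, m)` solves the game). -/
def current (P : ℝ) (u m : ℝ → ℝ) (x : ℝ) : ℝ := m x * (P + deriv u x)

/-- `w_n ⇀² w` in `L^q(𝕋 × 𝒴)` along the scales `ε_n`. -/
def WeakTwoScale (q : ℝ≥0∞) (ε : ℕ → ℝ) (w : ℕ → ℝ → ℝ) (w₀ : ℝ → ℝ → ℝ) : Prop :=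
  (∀ n, MemLp (w n) q cell) ∧ MemLp (fun z : ℝ × ℝ => w₀ z.1 z.2) q cell2 ∧
    ∀ ψ : ℝ → ℝ → ℝ, SmoothPeriodic2 ψ →
      Tendsto (fun n => ∫ x in (0 : ℝ)..1, w n x * ψ x (x / ε n)) atTop
        (𝓝 (∫ x in (0 : ℝ)..1, ∫ y in (0 : ℝ)..1, w₀ x y * ψ x y))

/-- `w_n →² w` in `L^q(𝕋 × 𝒴)` along the scales `ε_n`. -/
def StrongTwoScale (q : ℝ≥0∞) (ε : ℕ → ℝ) (w : ℕ → ℝ → ℝ) (w₀ : ℝ → ℝ → ℝ) : Prop :=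
  WeakTwoScale q ε w w₀ ∧
    Tendsto (fun n => eLpNorm (w n) q cell) atTop
      (𝓝 (eLpNorm (fun z : ℝ × ℝ => w₀ z.1 z.2) q cell2))

/-- Weak convergence in `L^q(𝕋)`, `1 ≤ q < ∞`: convergence against every function of the dual
space `L^{q'}(𝕋)`. -/
def WeakLq (q : ℝ≥0∞) (w : ℕ → ℝ → ℝ) (w₀ : ℝ → ℝ) : Prop :=
  (∀ n, MemLp (w n) q cell) ∧ MemLp w₀ q cell ∧
    ∀ q' : ℝ≥0∞, ENNReal.HolderConjugate q q' → ∀ g : ℝ → ℝ, MemLp g q' cell →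
      Tendsto (fun n => ∫ x in (0 : ℝ)..1, w n x * g x) atTop
        (𝓝 (∫ x in (0 : ℝ)..1, w₀ x * g x))

/-- `dv` is the weak derivative of `v` on the torus (equivalently, of the `𝒴`-periodic `v`). -/
def IsWeakDeriv (v dv : ℝ → ℝ) : Prop :=
  ∀ φ : ℝ → ℝ, SmoothPeriodic φ →
    ∫ x in (0 : ℝ)..1, v x * deriv φ x = -∫ x in (0 : ℝ)..1, dv x * φ x

/-- `v ∈ W^{1,q}(𝕋)` with weak derivative `dv`. -/
def MemW1q (q : ℝ≥0∞) (v dv : ℝ → ℝ) : Prop :=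
  MemLp v q cell ∧ MemLp dv q cell ∧ IsWeakDeriv v dv

/-- `w` represents an element of `L^q(𝕋; W^{1,q}_#(𝒴)/ℝ)`, with weak `y`-derivative `dw`. Being a
representative modulo constants in `y`, `w` is an `L^q` function up to a function of `x` alone. -/
def MemLqW1qModConst (q : ℝ≥0∞) (w dw : ℝ → ℝ → ℝ) : Prop :=
  (∃ c : ℝ → ℝ, MemLp (fun z : ℝ × ℝ => w z.1 z.2 - c z.1) q cell2) ∧
    MemLp (fun z : ℝ × ℝ => dw z.1 z.2) q cell2 ∧
    ∀ᵐ x ∂cell, IsWeakDeriv (w x) (dw x)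

/-- `(u₀, u₁, m, H, j)` is the limit of the solutions `(u_n, m_n, H_n)` and of their currents
along the scales `ε_n`; the exponent `q` refers to the Sobolev spaces. -/
def IsHomogenizedLimit (P : ℝ) (q : ℝ≥0∞) (ε : ℕ → ℝ) (us ms : ℕ → ℝ → ℝ) (Hs : ℕ → ℝ)
    (u₀ : ℝ → ℝ) (u₁ m : ℝ → ℝ → ℝ) (H j : ℝ) : Prop :=
  Function.Periodic u₀ 1 ∧
  (∃ α : ℝ≥0, 0 < α ∧ α < 1 ∧ ∃ C : ℝ≥0, HolderWith C α u₀) ∧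
  ∫ x in (0 : ℝ)..1, u₀ x = 0 ∧
  Integrable (fun z : ℝ × ℝ => m z.1 z.2) cell2 ∧
  ∫ x in (0 : ℝ)..1, ∫ y in (0 : ℝ)..1, m x y = 1 ∧
  (∃ (du₀ : ℝ → ℝ) (du₁ : ℝ → ℝ → ℝ),
    MemW1q q u₀ du₀ ∧ MemLqW1qModConst q u₁ du₁ ∧
    -- `u_n ⇀ u₀` in `W^{1,q}(𝕋)`
    WeakLq q us u₀ ∧ WeakLq q (fun n => deriv (us n)) du₀ ∧
    WeakTwoScale q ε (fun n => deriv (us n)) (fun x y => du₀ x + du₁ x y)) ∧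
  Tendsto (fun n => eLpNorm (fun x => us n x - u₀ x) ⊤ cell) atTop (𝓝 0) ∧
  WeakTwoScale 1 ε ms m ∧
  WeakLq 1 ms (fun x => ∫ y in (0 : ℝ)..1, m x y) ∧
  Tendsto Hs atTop (𝓝 H) ∧
  (∀ x ∈ Icc (0 : ℝ) 1, Tendsto (fun n => current P (us n) (ms n) x) atTop (𝓝 j))

/-- `F(t) = j²/(2t²) - ln t`, for `t > 0`. -/
def F (j t : ℝ) : ℝ := j ^ 2 / (2 * t ^ 2) - Real.log t

theorem F_strictAntiOn (j : ℝ) : StrictAntiOn (F j) (Ioi 0) := by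
  intro a ha b hb hab
  have ha' : (0 : ℝ) < a := ha
  have h1 : Real.log a < Real.log b := Real.log_lt_log ha' hab
  have h2 : j ^ 2 / (2 * b ^ 2) ≤ j ^ 2 / (2 * a ^ 2) := by
    gcongr
  unfold F
  linarith

/-- `F` is a bijection of `(0,∞)` onto `ℝ`, so that `F⁻¹ : ℝ → (0,∞)` is defined everywhere. -/
theorem F_bijOn (j : ℝ) : BijOn (F j) (Ioi 0) univ := by
  refine ⟨fun _ _ => mem_univ _, (F_strictAntiOn j).injOn, ?_⟩
  intro s _
  have hcont : ContinuousOn (F j) (Ioi 0) := by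
    intro t ht
    have ht' : t ≠ 0 := ne_of_gt ht
    unfold F
    apply ContinuousAt.continuousWithinAt
    have := Real.continuousAt_log ht'
    have h2 : (2 : ℝ) * t ^ 2 ≠ 0 := by positivity
    fun_prop (disch := assumption)
  have ha : (0 : ℝ) < Real.exp (-s) := Real.exp_pos _
  have hb : (0 : ℝ) < Real.exp (|s| + j ^ 2 / 2) := Real.exp_pos _
  have hFa : s ≤ F j (Real.exp (-s)) := by
    unfold F
    rw [Real.log_exp]
    have : 0 ≤ j ^ 2 / (2 * Real.exp (-s) ^ 2) := by positivity
    linarith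
  have hFb : F j (Real.exp (|s| + j ^ 2 / 2)) ≤ s := by
    unfold F
    rw [Real.log_exp]
    have h1 : 1 ≤ Real.exp (|s| + j ^ 2 / 2) := Real.one_le_exp (by positivity)
    have h2 : j ^ 2 / (2 * Real.exp (|s| + j ^ 2 / 2) ^ 2) ≤ j ^ 2 / 2 := by
      apply div_le_div_of_nonneg_left (by positivity) (by norm_num)
      nlinarith
    linarith [neg_abs_le s]
  exact (convex_Ioi (0 : ℝ)).isPreconnected.intermediate_value hb ha hcont ⟨hFb, hFa⟩

/-- `F⁻¹ : ℝ → (0,∞)`. -/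
def Finv (j : ℝ) : ℝ → ℝ := Function.invFunOn (F j) (Ioi 0)

end PeriodicMFG

end

/-! The current `j` of a solution is constant, so the Hamilton-Jacobi equation becomes the
pointwise identity `F j (m x) = H - V x (x / ε)`. Since `log ∘ (F j)⁻¹` is `1`-Lipschitz, `(F j)⁻¹`
depends continuously on `j` and its argument jointly; as `∫ m = 1`, the density takes the value `1`
somewhere, and this bounds `m`, `H` and `j` uniformly in `ε`.

Along a subsequence with `H → H₀` and `j → j₀`, the functions `m` and `u' = j / m - P` are therefore
uniformly close to oscillating profiles `G x (x / ε)` with `G` continuous. The integral of such a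
profile over any interval converges to that of its cell mean, which yields the two-scale limits of
`m` and `u'` and, after one more integration, the uniform limit of `u`. Conversely a weak two-scale
limit is unique almost everywhere, so every limit of the subsequence is given by these profiles. -/

namespace PeriodicMFG

/-! ### The unit cell -/

instance : IsProbabilityMeasure cell := ⟨by simp [cell]⟩

instance : IsProbabilityMeasure cell2 := by unfold cell2; infer_instance

section Cell

variable {E : Type*} [NormedAddCommGroup E]

theorem ae_cell_mem : ∀ᵐ x ∂cell, x ∈ Ioc (0 : ℝ) 1 := ae_restrict_mem measurableSet_Ioc

theorem ae_cell2_mem : ∀ᵐ z ∂cell2, z ∈ Ioc (0 : ℝ) 1 ×ˢ Ioc (0 : ℝ) 1 :=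
  (Measure.quasiMeasurePreserving_fst.ae ae_cell_mem).and
    (Measure.quasiMeasurePreserving_snd.ae ae_cell_mem)

theorem memLp_cell_of_continuous {f : ℝ → E} (hf : Continuous f) (p : ℝ≥0∞) :
    MemLp f p cell := by
  obtain ⟨C, hC⟩ := isCompact_Icc.exists_bound_of_continuousOn (s := Icc (0 : ℝ) 1)
    hf.continuousOn
  refine MemLp.of_bound hf.aestronglyMeasurable C ?_
  filter_upwards [ae_cell_mem] with x hx using hC x (Ioc_subset_Icc_self hx)

theorem memLp_cell2_of_continuous {f : ℝ × ℝ → E} (hf : Continuous f) (p : ℝ≥0∞) :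
    MemLp f p cell2 := by
  obtain ⟨C, hC⟩ := (isCompact_Icc.prod isCompact_Icc).exists_bound_of_continuousOn
    (s := Icc (0 : ℝ) 1 ×ˢ Icc (0 : ℝ) 1) hf.continuousOn
  refine MemLp.of_bound hf.aestronglyMeasurable C ?_
  filter_upwards [ae_cell2_mem] with z hz
  exact hC z ⟨Ioc_subset_Icc_self hz.1, Ioc_subset_Icc_self hz.2⟩

variable [NormedSpace ℝ E]

theorem integral_cell (f : ℝ → E) : ∫ x, f x ∂cell = ∫ x in (0 : ℝ)..1, f x := by
  rw [intervalIntegral.integral_of_le zero_le_one, cell]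

theorem integral_cell2 {f : ℝ → ℝ → E} (hf : Integrable (fun z : ℝ × ℝ => f z.1 z.2) cell2) :
    ∫ z, f z.1 z.2 ∂cell2 = ∫ x in (0 : ℝ)..1, ∫ y in (0 : ℝ)..1, f x y := by
  unfold cell2 at hf ⊢
  rw [integral_prod _ hf, ← integral_cell]
  simp only [integral_cell]

theorem intervalIntegral_congr_cell {f g : ℝ → E} (h : f =ᵐ[cell] g) {a b : ℝ}
    (ha : a ∈ Icc (0 : ℝ) 1) (hb : b ∈ Icc (0 : ℝ) 1) :
    ∫ x in a..b, f x = ∫ x in a..b, g x :=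
  intervalIntegral.integral_congr_ae_restrict <| ae_mono (Measure.restrict_mono
    (Ioc_subset_Ioc (le_min ha.1 hb.1) (max_le ha.2 hb.2)) le_rfl) h

theorem ae_intervalIntegral_eq_of_ae_cell2 {f g : ℝ → ℝ → E}
    (h : ∀ᵐ z ∂cell2, f z.1 z.2 = g z.1 z.2) :
    ∀ᵐ x ∂cell, ∀ b ∈ Icc (0 : ℝ) 1, ∫ y in (0 : ℝ)..b, f x y = ∫ y in (0 : ℝ)..b, g x y := by
  filter_upwards [Measure.ae_ae_of_ae_prod h] with x hx b hb
  exact intervalIntegral_congr_cell hx (left_mem_Icc.2 zero_le_one) hb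

theorem intervalIntegral_intervalIntegral_congr_cell2 {f g : ℝ → ℝ → E}
    (h : ∀ᵐ z ∂cell2, f z.1 z.2 = g z.1 z.2) {b : ℝ} (hb : b ∈ Icc (0 : ℝ) 1) :
    ∫ x in (0 : ℝ)..b, ∫ y in (0 : ℝ)..1, f x y = ∫ x in (0 : ℝ)..b, ∫ y in (0 : ℝ)..1, g x y :=
  intervalIntegral_congr_cell ((ae_intervalIntegral_eq_of_ae_cell2 h).mono
    fun _ hx => hx 1 (right_mem_Icc.2 zero_le_one)) (left_mem_Icc.2 zero_le_one) hb

end Cell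

/-! ### Averaging of oscillating functions -/

theorem isCompact_image_prod_univ_of_periodic {X E : Type*} [TopologicalSpace X]
    [TopologicalSpace E] {G : X → ℝ → E} (hG : Continuous fun z : X × ℝ => G z.1 z.2)
    (hper : ∀ x, Function.Periodic (G x) 1) {K : Set X} (hK : IsCompact K) :
    IsCompact ((fun z : X × ℝ => G z.1 z.2) '' K ×ˢ univ) := by
  convert (hK.prod isCompact_Icc).image hG using 1
  refine (image_mono (prod_mono_right (subset_univ (Icc (0 : ℝ) 1)))).antisymm' ?_
  rintro _ ⟨⟨x, y⟩, ⟨hx, -⟩, rfl⟩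
  obtain ⟨y', hy', h⟩ := (hper x).exists_mem_Ico₀ one_pos y
  exact ⟨(x, y'), ⟨hx, Ico_subset_Icc_self hy'⟩, h.symm⟩

theorem exists_norm_le_of_periodic {X E : Type*} [TopologicalSpace X]
    [SeminormedAddCommGroup E] {G : X → ℝ → E} (hG : Continuous fun z : X × ℝ => G z.1 z.2)
    (hper : ∀ x, Function.Periodic (G x) 1) {K : Set X} (hK : IsCompact K) :
    ∃ B, ∀ x ∈ K, ∀ y, ‖G x y‖ ≤ B := by
  obtain ⟨B, hB⟩ := (isCompact_image_prod_univ_of_periodic hG hper hK).isBounded.exists_norm_le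
  exact ⟨B, fun x hx y => hB _ ⟨(x, y), ⟨hx, mem_univ y⟩, rfl⟩⟩

theorem exists_modulus_of_periodic {X E : Type*} [PseudoMetricSpace X] [PseudoMetricSpace E]
    {G : X → ℝ → E} (hG : Continuous fun z : X × ℝ => G z.1 z.2)
    (hper : ∀ x, Function.Periodic (G x) 1) {K : Set X} (hK : IsCompact K) {η : ℝ} (hη : 0 < η) :
    ∃ δ > 0, ∀ x ∈ K, ∀ x' ∈ K, dist x x' < δ → ∀ y, dist (G x y) (G x' y) < η := by
  obtain ⟨δ, hδ, h⟩ := Metric.uniformContinuousOn_iff.1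
    ((hK.prod isCompact_Icc).uniformContinuousOn_of_continuous hG.continuousOn) η hη
  refine ⟨δ, hδ, fun x hx x' hx' hxx' y => ?_⟩
  have hper' : Function.Periodic (fun y => (G x y, G x' y)) 1 := fun y =>
    Prod.ext (hper x y) (hper x' y)
  obtain ⟨y', hy', hyy'⟩ := hper'.exists_mem_Ico₀ one_pos y
  rw [Prod.mk.injEq] at hyy'
  rw [hyy'.1, hyy'.2]
  refine h (x, y') ⟨hx, Ico_subset_Icc_self hy'⟩ (x', y') ⟨hx', Ico_subset_Icc_self hy'⟩ ?_
  rw [Prod.dist_eq, dist_self]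
  exact max_lt hxx' hδ

section Averaging

variable {E : Type*} [NormedAddCommGroup E] [NormedSpace ℝ E]

theorem norm_integral_sub_integral_shift_le {f : ℝ → E} (hf : Continuous f) {a b h B : ℝ}
    (hB : ∀ x ∈ Icc (a - |h|) (b + |h|), ‖f x‖ ≤ B) (hab : a ≤ b) :
    ‖(∫ x in a..b, f x) - ∫ x in a..b, f (x + h)‖ ≤ 2 * B * |h| := by
  have hsmall : ∀ c ∈ Icc a b, ‖∫ x in c..(c + h), f x‖ ≤ B * |h| := fun c hc => by
    convert intervalIntegral.norm_integral_le_of_norm_le_const (fun x hx => hB x ?_) using 2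
    · rw [add_sub_cancel_left]
    · have hxc : |x - c| ≤ |h| := by
        simpa using abs_sub_left_of_mem_uIcc (uIoc_subset_uIcc hx)
      rw [abs_le] at hxc
      exact ⟨by linarith [hc.1], by linarith [hc.2]⟩
  rw [intervalIntegral.integral_comp_add_right f,
    intervalIntegral.integral_interval_sub_interval_comm (hf.intervalIntegrable _ _)
      (hf.intervalIntegrable _ _) (hf.intervalIntegrable _ _)]
  calc _ ≤ _ := norm_sub_le _ _
    _ ≤ B * |h| + B * |h| := add_le_add (hsmall a ⟨le_rfl, hab⟩) (hsmall b ⟨hab, le_rfl⟩)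
    _ = 2 * B * |h| := by ring

theorem integral_integral_eq_integral_integral_shift {G : ℝ → ℝ → E}
    (hG : Continuous fun z : ℝ × ℝ => G z.1 z.2) (hper : ∀ x, Function.Periodic (G x) 1)
    {θ : ℝ → ℝ} (hθ : Continuous θ) (a b : ℝ) :
    ∫ x in a..b, ∫ y in (0 : ℝ)..1, G x y = ∫ s in (0 : ℝ)..1, ∫ x in a..b, G x (θ x + s) := by
  have hshift : ∀ x, ∫ s in (0 : ℝ)..1, G x (θ x + s) = ∫ y in (0 : ℝ)..1, G x y := fun x => by
    rw [intervalIntegral.integral_comp_add_left, add_zero, (hper x).intervalIntegral_add_eq _ 0,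
      zero_add]
  have hcont : Continuous fun z : ℝ × ℝ => G z.2 (θ z.2 + z.1) :=
    hG.comp (f := fun z : ℝ × ℝ => (z.2, θ z.2 + z.1)) (by fun_prop)
  simp only [← hshift]
  exact (intervalIntegral_intervalIntegral_swap (F := fun s x => G x (θ x + s))
    ((hcont.continuousOn.integrableOn_compact (isCompact_uIcc.prod isCompact_uIcc)).mono_set
      (prod_mono uIoc_subset_uIcc uIoc_subset_uIcc))).symm

theorem norm_integral_oscillating_sub_translate_le {G : ℝ → ℝ → E}
    (hG : Continuous fun z : ℝ × ℝ => G z.1 z.2) {θ : ℝ → ℝ} (hθ : Continuous θ)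
    {a b h B η : ℝ} (hab : a ≤ b) (hB : ∀ x ∈ Icc (a - |h|) (b + |h|), ∀ y, ‖G x y‖ ≤ B)
    (hη : ∀ x ∈ Icc a b, ∀ y, ‖G (x + h) y - G x y‖ ≤ η) :
    ‖(∫ x in a..b, G x (θ x)) - ∫ x in a..b, G x (θ (x + h))‖ ≤ 2 * B * |h| + η * (b - a) := by
  have hcont : ∀ {f g : ℝ → ℝ}, Continuous f → Continuous g →
      Continuous fun x => G (f x) (g x) := fun hf hg => hG.comp (hf.prodMk hg)
  have htranslate : ‖(∫ x in a..b, G x (θ x)) - ∫ x in a..b, G (x + h) (θ (x + h))‖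
      ≤ 2 * B * |h| :=
    norm_integral_sub_integral_shift_le (hcont continuous_id hθ) (fun x hx => hB x hx _) hab
  have hmodulus : ‖(∫ x in a..b, G (x + h) (θ (x + h))) - ∫ x in a..b, G x (θ (x + h))‖
      ≤ η * (b - a) := by
    rw [← intervalIntegral.integral_sub
      ((hcont (by fun_prop) (by fun_prop)).intervalIntegrable _ _)
      ((hcont (by fun_prop) (by fun_prop)).intervalIntegrable _ _), ← abs_of_nonneg
      (sub_nonneg.2 hab)]
    refine intervalIntegral.norm_integral_le_of_norm_le_const fun x hx => hη x ?_ _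
    rw [uIoc_of_le hab] at hx
    exact Ioc_subset_Icc_self hx
  exact (norm_sub_le_norm_sub_add_norm_sub _ _ _).trans (add_le_add htranslate hmodulus)

variable [CompleteSpace E]

/-- Translating `x` by `ε s` shifts the fast variable `x / ε` by `s`, so up to the modulus of
continuity of `G` in `x` the oscillating integral agrees with its average over `s ∈ [0,1]`. -/
theorem norm_integral_oscillating_sub_integral_mean_le {G : ℝ → ℝ → E}
    (hG : Continuous fun z : ℝ × ℝ => G z.1 z.2) (hper : ∀ x, Function.Periodic (G x) 1)
    {ε a b B η : ℝ} (hε : ε ≠ 0) (hab : a ≤ b)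
    (hB : ∀ x ∈ Icc (a - |ε|) (b + |ε|), ∀ y, ‖G x y‖ ≤ B)
    (hη : ∀ h, |h| ≤ |ε| → ∀ x ∈ Icc a b, ∀ y, ‖G (x + h) y - G x y‖ ≤ η) :
    ‖(∫ x in a..b, G x (x / ε)) - ∫ x in a..b, ∫ y in (0 : ℝ)..1, G x y‖
      ≤ 2 * B * |ε| + η * (b - a) := by
  have hB0 : 0 ≤ B := (norm_nonneg _).trans <|
    hB a ⟨by linarith [abs_nonneg ε], by linarith [abs_nonneg ε]⟩ 0
  have hcont : Continuous fun s => ∫ x in a..b, G x (x / ε + s) :=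
    intervalIntegral.continuous_parametric_intervalIntegral_of_continuous'
      (f := fun s x => G x (x / ε + s))
      (hG.comp (f := fun z : ℝ × ℝ => (z.2, z.2 / ε + z.1)) (by fun_prop)) _ _
  have hθ : Continuous fun x => x / ε := continuous_id.div_const ε
  have hconst : ∫ x in a..b, G x (x / ε)
      = ∫ _s in (0 : ℝ)..1, ∫ x in a..b, G x (x / ε) := by
    rw [intervalIntegral.integral_const, sub_zero, one_smul]
  rw [integral_integral_eq_integral_integral_shift hG hper hθ, hconst,
    ← intervalIntegral.integral_sub intervalIntegrable_const (hcont.intervalIntegrable _ _)]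
  refine (intervalIntegral.norm_integral_le_of_norm_le_const fun s hs => ?_).trans_eq
    (b := (2 * B * |ε| + η * (b - a)) * |1 - 0|) (by rw [sub_zero, abs_one, mul_one])
  rw [uIoc_of_le zero_le_one] at hs
  have hs' : |ε * s| ≤ |ε| := by
    rw [abs_mul, abs_of_pos hs.1]; exact mul_le_of_le_one_right (abs_nonneg ε) hs.2
  have hshift : ∀ x, x / ε + s = (x + ε * s) / ε := fun x => by field_simp
  simp only [hshift]
  refine (norm_integral_oscillating_sub_translate_le hG hθ hab
    (fun x hx => hB x ⟨by linarith [hx.1], by linarith [hx.2]⟩) (hη _ hs')).trans ?_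
  gcongr

theorem tendstoUniformlyOn_integral_oscillating {G : ℝ → ℝ → E}
    (hG : Continuous fun z : ℝ × ℝ => G z.1 z.2) (hper : ∀ x, Function.Periodic (G x) 1)
    (a b : ℝ) :
    TendstoUniformlyOn (fun ε t => ∫ x in a..t, G x (x / ε))
      (fun t => ∫ x in a..t, ∫ y in (0 : ℝ)..1, G x y) (𝓝[≠] 0) (Icc a b) := by
  rw [Metric.tendstoUniformlyOn_iff]
  intro η hη
  obtain ⟨B, hB⟩ := exists_norm_le_of_periodic hG hper (isCompact_Icc (a := a - 1) (b := b + 1))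
  obtain ⟨κ, hκ, hκη⟩ := exists_pos_mul_lt (half_pos hη) (b - a)
  obtain ⟨δ, hδ, hmod⟩ := exists_modulus_of_periodic hG hper
    (isCompact_Icc (a := a - 1) (b := b + 1)) hκ
  have hsmall : ∀ᶠ ε in 𝓝[≠] (0 : ℝ), |ε| < δ ∧ |ε| ≤ 1 ∧ 2 * B * |ε| < η / 2 := by
    refine Filter.Eventually.filter_mono nhdsWithin_le_nhds ?_
    have h0 : Tendsto (fun ε : ℝ => |ε|) (𝓝 0) (𝓝 0) := by
      simpa using (continuous_abs (G := ℝ)).tendsto 0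
    have hB0 : Tendsto (fun ε : ℝ => 2 * B * |ε|) (𝓝 0) (𝓝 0) := by
      simpa using h0.const_mul (2 * B)
    exact (h0.eventually_lt_const hδ).and
      ((h0.eventually_le_const one_pos).and (hB0.eventually_lt_const (half_pos hη)))
  filter_upwards [hsmall, self_mem_nhdsWithin] with ε ⟨hεδ, hε1, hεB⟩ hε t ht
  rw [dist_comm, dist_eq_norm]
  calc _ ≤ 2 * B * |ε| + κ * (t - a) :=
        norm_integral_oscillating_sub_integral_mean_le hG hper hε ht.1
          (fun x hx => hB x ⟨by linarith [hx.1], by linarith [hx.2, ht.2]⟩) fun h hh x hx y => by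
            rw [← dist_eq_norm]
            rw [abs_le] at hh
            refine (hmod _ ⟨by linarith [hx.1], by linarith [hx.2, ht.2]⟩ _
              ⟨by linarith [hx.1], by linarith [hx.2, ht.2]⟩ ?_ y).le
            rw [Real.dist_eq, add_sub_cancel_left]
            exact (abs_le.2 hh).trans_lt hεδ
    _ ≤ 2 * B * |ε| + (b - a) * κ := by rw [mul_comm κ]; gcongr; exact ht.2
    _ < η := by linarith

end Averaging

/-! ### Asymptotic profiles -/

theorem continuous_cell_mean {E : Type*} [NormedAddCommGroup E] [NormedSpace ℝ E] {G : ℝ → ℝ → E}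
    (hG : Continuous fun z : ℝ × ℝ => G z.1 z.2) :
    Continuous fun x => ∫ y in (0 : ℝ)..1, G x y :=
  intervalIntegral.continuous_parametric_intervalIntegral_of_continuous' hG _ _

/-- The continuous functions `w n` are uniformly asymptotic on `[0,1]` to the oscillating functions
`x ↦ G x (x / ε n)`, with `G` jointly continuous and `1`-periodic in its second variable. This is
the form in which two-scale convergence occurs here: unlike weak two-scale convergence, it is
preserved by nonlinear continuous maps. -/
structure IsAsymptoticProfile {E : Type*} [PseudoMetricSpace E] (ε : ℕ → ℝ) (w : ℕ → ℝ → E)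
    (G : ℝ → ℝ → E) : Prop where
  continuous_seq : ∀ n, Continuous (w n)
  continuous_profile : Continuous fun z : ℝ × ℝ => G z.1 z.2
  periodic : ∀ x, Function.Periodic (G x) 1
  eventually_dist_lt : ∀ η > 0, ∀ᶠ n in atTop, ∀ x ∈ Icc (0 : ℝ) 1,
    dist (w n x) (G x (x / ε n)) < η

theorem norm_integral_mul_sub_integral_mul_le {α : Type*} [MeasurableSpace α] {μ : Measure α}
    {f g k : α → ℝ} {B : ℝ} (hf : AEStronglyMeasurable f μ) (hB : ∀ᵐ x ∂μ, ‖f x‖ ≤ B)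
    (hg : Integrable g μ) (hk : Integrable k μ) :
    ‖(∫ x, f x * g x ∂μ) - ∫ x, f x * k x ∂μ‖ ≤ B * ∫ x, ‖g x - k x‖ ∂μ := by
  rw [← integral_sub (hg.bdd_mul hf hB) (hk.bdd_mul hf hB), ← integral_const_mul]
  refine norm_integral_le_of_norm_le ((hg.sub hk).norm.const_mul B) ?_
  filter_upwards [hB] with x hx
  rw [← mul_sub, norm_mul]
  gcongr

theorem tendsto_integral_mul_of_hasCompactSupport {α ι : Type*} [TopologicalSpace α]
    [NormalSpace α] [R1Space α] [WeaklyLocallyCompactSpace α] [MeasurableSpace α] [BorelSpace α]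
    {μ : Measure α} [μ.Regular]
    {l : Filter ι} {f : ι → α → ℝ} {f₀ : α → ℝ} {B : ℝ}
    (hf : ∀ i, AEStronglyMeasurable (f i) μ) (hf₀ : AEStronglyMeasurable f₀ μ)
    (hB : ∀ᶠ i in l, ∀ᵐ x ∂μ, ‖f i x‖ ≤ B) (hB₀ : ∀ᵐ x ∂μ, ‖f₀ x‖ ≤ B)
    (h : ∀ k, Continuous k → HasCompactSupport k →
      Tendsto (fun i => ∫ x, f i x * k x ∂μ) l (𝓝 (∫ x, f₀ x * k x ∂μ)))
    {g : α → ℝ} (hg : Integrable g μ) :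
    Tendsto (fun i => ∫ x, f i x * g x ∂μ) l (𝓝 (∫ x, f₀ x * g x ∂μ)) := by
  rw [Metric.tendsto_nhds]
  intro η hη
  obtain ⟨c, hc, hcη⟩ := exists_pos_mul_lt (div_pos hη three_pos) |B|
  obtain ⟨k, hks, hgk, hkc, hki⟩ := hg.exists_hasCompactSupport_integral_sub_le hc
  have hBη : B * ∫ x, ‖g x - k x‖ ∂μ < η / 3 := by
    refine lt_of_le_of_lt ?_ hcη
    gcongr
    exact le_abs_self B
  have h₀ := (norm_integral_mul_sub_integral_mul_le hf₀ hB₀ hg hki).trans_lt hBη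
  filter_upwards [hB, Metric.tendsto_nhds.1 (h k hkc hks) (η / 3) (by positivity)] with i hBi hi
  have h₁ := (norm_integral_mul_sub_integral_mul_le (hf i) hBi hg hki).trans_lt hBη
  rw [← dist_eq_norm] at h₀ h₁
  rw [dist_comm] at h₀
  calc _ ≤ _ := dist_triangle4 _ (∫ x, f i x * k x ∂μ) (∫ x, f₀ x * k x ∂μ) _
    _ < η := by linarith

namespace IsAsymptoticProfile

section MetricValued

variable {E F : Type*} [PseudoMetricSpace E] [PseudoMetricSpace F] {ε : ℕ → ℝ} {w : ℕ → ℝ → E}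
  {G : ℝ → ℝ → E} {v : ℕ → ℝ → F} {K : ℝ → ℝ → F}

theorem oscillating (hG : Continuous fun z : ℝ × ℝ => G z.1 z.2)
    (hper : ∀ x, Function.Periodic (G x) 1) (ε : ℕ → ℝ) :
    IsAsymptoticProfile ε (fun n x => G x (x / ε n)) G where
  continuous_seq n := hG.comp (by fun_prop : Continuous fun x : ℝ => (x, x / ε n))
  continuous_profile := hG
  periodic := hper
  eventually_dist_lt η hη := by simp [hη]

theorem of_tendstoUniformlyOn {w₀ : ℝ → E} (hw : ∀ n, Continuous (w n)) (hw₀ : Continuous w₀)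
    (h : TendstoUniformlyOn w w₀ atTop (Icc 0 1)) (ε : ℕ → ℝ) :
    IsAsymptoticProfile ε w (fun x _ => w₀ x) where
  continuous_seq := hw
  continuous_profile := hw₀.comp continuous_fst
  periodic _ _ := rfl
  eventually_dist_lt η hη := by
    simpa only [dist_comm] using Metric.tendstoUniformlyOn_iff.1 h η hη

theorem const {c : ℕ → E} {c₀ : E} (hc : Tendsto c atTop (𝓝 c₀)) (ε : ℕ → ℝ) :
    IsAsymptoticProfile ε (fun n _ => c n) (fun _ _ => c₀) :=
  of_tendstoUniformlyOn (fun _ => continuous_const) continuous_const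
    (hc.tendstoUniformlyOn_const _) ε

theorem congr (h : IsAsymptoticProfile ε w G) {w' : ℕ → ℝ → E} (hw' : ∀ n, Continuous (w' n))
    (hw : ∀ n, EqOn (w' n) (w n) (Icc 0 1)) : IsAsymptoticProfile ε w' G where
  continuous_seq := hw'
  continuous_profile := h.continuous_profile
  periodic := h.periodic
  eventually_dist_lt η hη := by
    filter_upwards [h.eventually_dist_lt η hη] with n hn x hx
    rw [hw n hx]
    exact hn x hx

theorem prodMk (h : IsAsymptoticProfile ε w G) (k : IsAsymptoticProfile ε v K) :
    IsAsymptoticProfile ε (fun n x => (w n x, v n x)) (fun x y => (G x y, K x y)) where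
  continuous_seq n := (h.continuous_seq n).prodMk (k.continuous_seq n)
  continuous_profile := h.continuous_profile.prodMk k.continuous_profile
  periodic x y := Prod.ext (h.periodic x y) (k.periodic x y)
  eventually_dist_lt η hη := by
    filter_upwards [h.eventually_dist_lt η hη, k.eventually_dist_lt η hη] with n hn kn x hx
    exact max_lt (hn x hx) (kn x hx)

/-- The profile has relatively compact range, near which `Φ` is uniformly continuous. -/
theorem comp (h : IsAsymptoticProfile ε w G) {Φ : E → F} (hΦ : Continuous Φ) :
    IsAsymptoticProfile ε (fun n x => Φ (w n x)) (fun x y => Φ (G x y)) where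
  continuous_seq n := hΦ.comp (h.continuous_seq n)
  continuous_profile := hΦ.comp h.continuous_profile
  periodic x := (h.periodic x).comp Φ
  eventually_dist_lt η hη := by
    obtain ⟨δ, hδ, hΦδ⟩ := Metric.mem_uniformity_dist.1 <|
      (isCompact_image_prod_univ_of_periodic h.continuous_profile h.periodic
        isCompact_Icc).uniformContinuousAt_of_continuousAt Φ (fun _ _ => hΦ.continuousAt)
        (Metric.dist_mem_uniformity hη)
    filter_upwards [h.eventually_dist_lt δ hδ] with n hn x hx
    rw [dist_comm]
    exact hΦδ ((dist_comm _ _).trans_lt (hn x hx)) ⟨(x, x / ε n), ⟨hx, mem_univ _⟩, rfl⟩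

end MetricValued

section NormedValued

variable {E : Type*} [NormedAddCommGroup E] {ε : ℕ → ℝ} {w : ℕ → ℝ → E} {G : ℝ → ℝ → E}

theorem exists_bound (h : IsAsymptoticProfile ε w G) :
    ∃ B, (∀ x ∈ Icc (0 : ℝ) 1, ∀ y, ‖G x y‖ ≤ B) ∧
      ∀ᶠ n in atTop, ∀ x ∈ Icc (0 : ℝ) 1, ‖w n x‖ ≤ B := by
  obtain ⟨B, hB⟩ := exists_norm_le_of_periodic h.continuous_profile h.periodic isCompact_Icc
  refine ⟨1 + B, fun x hx y => (hB x hx y).trans (by linarith), ?_⟩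
  filter_upwards [h.eventually_dist_lt 1 one_pos] with n hn x hx
  rw [← sub_add_cancel (w n x) (G x (x / ε n))]
  exact norm_add_le_of_le ((dist_eq_norm _ _).symm.trans_le (hn x hx).le) (hB x hx _)

variable [NormedSpace ℝ E] [CompleteSpace E]

theorem tendstoUniformlyOn_integral (h : IsAsymptoticProfile ε w G)
    (hε : Tendsto ε atTop (𝓝[≠] 0)) :
    TendstoUniformlyOn (fun n t => ∫ x in (0 : ℝ)..t, w n x)
      (fun t => ∫ x in (0 : ℝ)..t, ∫ y in (0 : ℝ)..1, G x y) atTop (Icc 0 1) := by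
  rw [Metric.tendstoUniformlyOn_iff]
  intro η hη
  have hosc := hε.eventually <| Metric.tendstoUniformlyOn_iff.1
    (tendstoUniformlyOn_integral_oscillating h.continuous_profile h.periodic 0 1)
    (η / 2) (half_pos hη)
  filter_upwards [hosc, h.eventually_dist_lt (η / 2) (half_pos hη)] with n hn hwn t ht
  have hclose : dist (∫ x in (0 : ℝ)..t, G x (x / ε n)) (∫ x in (0 : ℝ)..t, w n x) ≤ η / 2 := by
    rw [dist_comm, dist_eq_norm, ← intervalIntegral.integral_sub
      ((h.continuous_seq n).intervalIntegrable _ _) (((oscillating h.continuous_profile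
        h.periodic ε).continuous_seq n).intervalIntegrable _ _)]
    refine (intervalIntegral.norm_integral_le_of_norm_le_const fun x hx => ?_).trans
      (mul_le_of_le_one_right (half_pos hη).le ?_)
    · rw [uIoc_of_le ht.1] at hx
      rw [← dist_eq_norm]
      exact (hwn x ⟨hx.1.le, hx.2.trans ht.2⟩).le
    · rw [sub_zero, abs_of_nonneg ht.1]
      exact ht.2
  calc _ ≤ _ := dist_triangle _ _ _
    _ < η / 2 + η / 2 := add_lt_add_of_lt_of_le (hn t ht) hclose
    _ = η := add_halves η

theorem tendsto_integral (h : IsAsymptoticProfile ε w G) (hε : Tendsto ε atTop (𝓝[≠] 0)) :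
    Tendsto (fun n => ∫ x in (0 : ℝ)..1, w n x) atTop
      (𝓝 (∫ x in (0 : ℝ)..1, ∫ y in (0 : ℝ)..1, G x y)) :=
  (h.tendstoUniformlyOn_integral hε).tendsto_at (right_mem_Icc.2 zero_le_one)

end NormedValued

section RealValued

variable {ε : ℕ → ℝ} {w v : ℕ → ℝ → ℝ} {G K : ℝ → ℝ → ℝ}

theorem mul (h : IsAsymptoticProfile ε w G) (k : IsAsymptoticProfile ε v K) :
    IsAsymptoticProfile ε (fun n x => w n x * v n x) (fun x y => G x y * K x y) :=
  (h.prodMk k).comp continuous_mul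

theorem tendsto_integral_mul (h : IsAsymptoticProfile ε w G) (hε : Tendsto ε atTop (𝓝[≠] 0))
    {g : ℝ → ℝ} (hg : Integrable g cell) :
    Tendsto (fun n => ∫ x in (0 : ℝ)..1, w n x * g x) atTop
      (𝓝 (∫ x in (0 : ℝ)..1, (∫ y in (0 : ℝ)..1, G x y) * g x)) := by
  obtain ⟨B, hB, hwB⟩ := h.exists_bound
  have hmeanB : ∀ x ∈ Icc (0 : ℝ) 1, ‖∫ y in (0 : ℝ)..1, G x y‖ ≤ B := fun x hx => by
    simpa using intervalIntegral.norm_integral_le_of_norm_le_const (a := 0) (b := 1)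
      fun y _ => hB x hx y
  have hae : ∀ {f : ℝ → ℝ}, (∀ x ∈ Icc (0 : ℝ) 1, ‖f x‖ ≤ B) → ∀ᵐ x ∂cell, ‖f x‖ ≤ B :=
    fun hf => ae_cell_mem.mono fun x hx => hf x (Ioc_subset_Icc_self hx)
  simp only [← integral_cell fun x => _ * g x]
  refine tendsto_integral_mul_of_hasCompactSupport
    (fun n => (h.continuous_seq n).aestronglyMeasurable)
    (continuous_cell_mean h.continuous_profile).aestronglyMeasurable
    (hwB.mono fun _ => hae) (hae hmeanB) (fun k hk _ => ?_) hg
  have hprofile := h.mul (oscillating (G := fun x _ => k x) (by fun_prop) (fun _ _ => rfl) ε)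
  simpa only [integral_cell, intervalIntegral.integral_mul_const]
    using hprofile.tendsto_integral hε

theorem weakTwoScale (h : IsAsymptoticProfile ε w G) (hε : Tendsto ε atTop (𝓝[≠] 0))
    (q : ℝ≥0∞) : WeakTwoScale q ε w G :=
  ⟨fun n => memLp_cell_of_continuous (h.continuous_seq n) q,
    memLp_cell2_of_continuous h.continuous_profile q,
    fun _ hψ => (h.mul (oscillating hψ.1.continuous hψ.2.2 ε)).tendsto_integral hε⟩

theorem weakLq (h : IsAsymptoticProfile ε w G) (hε : Tendsto ε atTop (𝓝[≠] 0)) (q : ℝ≥0∞) :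
    WeakLq q w (fun x => ∫ y in (0 : ℝ)..1, G x y) :=
  ⟨fun n => memLp_cell_of_continuous (h.continuous_seq n) q,
    memLp_cell_of_continuous (continuous_cell_mean h.continuous_profile) q,
    fun q' _ _ hg => h.tendsto_integral_mul hε
      (hg.integrable (ENNReal.HolderConjugate.one_le q' q))⟩

theorem tendsto_eLpNorm (h : IsAsymptoticProfile ε w G) (hε : Tendsto ε atTop (𝓝[≠] 0))
    {p : ℝ≥0∞} (hp0 : p ≠ 0) (hp : p ≠ ⊤) :
    Tendsto (fun n => eLpNorm (w n) p cell) atTop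
      (𝓝 (eLpNorm (fun z : ℝ × ℝ => G z.1 z.2) p cell2)) := by
  have hpr : 0 < p.toReal := ENNReal.toReal_pos hp0 hp
  have hpow : IsAsymptoticProfile ε (fun n x => ‖w n x‖ ^ p.toReal)
      (fun x y => ‖G x y‖ ^ p.toReal) :=
    h.comp (continuous_norm.rpow_const fun _ => Or.inr hpr.le)
  rw [(memLp_cell2_of_continuous h.continuous_profile p).eLpNorm_eq_integral_rpow_norm hp0 hp,
    integral_cell2 (f := fun x y => ‖G x y‖ ^ p.toReal)
      ((memLp_cell2_of_continuous hpow.continuous_profile 1).integrable le_rfl)]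
  simp_rw [fun n => (memLp_cell_of_continuous (h.continuous_seq n) p).eLpNorm_eq_integral_rpow_norm
    hp0 hp, integral_cell]
  exact (ENNReal.continuous_ofReal.tendsto _).comp
    ((hpow.tendsto_integral hε).rpow_const (Or.inr (inv_nonneg.2 hpr.le)))

theorem strongTwoScale (h : IsAsymptoticProfile ε w G) (hε : Tendsto ε atTop (𝓝[≠] 0))
    {p : ℝ≥0∞} (hp0 : p ≠ 0) (hp : p ≠ ⊤) : StrongTwoScale p ε w G :=
  ⟨h.weakTwoScale hε p, h.tendsto_eLpNorm hε hp0 hp⟩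

end RealValued

end IsAsymptoticProfile

/-! ### Periodic test functions -/

theorem isClosed_preimage_fract {K : Set (ℝ × ℝ)} (hK : IsCompact K)
    (hKI : K ⊆ Ico (0 : ℝ) 1 ×ˢ Ico (0 : ℝ) 1) :
    IsClosed ((fun z : ℝ × ℝ => (Int.fract z.1, Int.fract z.2)) ⁻¹' K) := by
  let π : ℝ × ℝ → UnitAddCircle × UnitAddCircle := fun z => (z.1, z.2)
  have hπ : Continuous π := by fun_prop
  have hcoe : ∀ s : ℝ, ((Int.fract s : ℝ) : UnitAddCircle) = s := AddCircle.coe_fract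
  have hinj : ∀ s : ℝ, ∀ t ∈ Ico (0 : ℝ) 1, (t : UnitAddCircle) = (s : UnitAddCircle) →
      Int.fract s = t := fun s t ht h =>
    (AddCircle.coe_eq_coe_iff_of_mem_Ico (p := (1 : ℝ)) (a := 0)
      (by simp [Int.fract_nonneg, Int.fract_lt_one]) (by simpa using ht)).1 ((hcoe s).trans h.symm)
  have heq : (fun z : ℝ × ℝ => (Int.fract z.1, Int.fract z.2)) ⁻¹' K = π ⁻¹' (π '' K) := by
    ext z
    refine ⟨fun hz => ⟨_, hz, Prod.ext (hcoe z.1) (hcoe z.2)⟩, ?_⟩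
    rintro ⟨k, hk, hkz⟩
    have hz : (Int.fract z.1, Int.fract z.2) = k :=
      Prod.ext (hinj _ _ (hKI hk).1 (congrArg Prod.fst hkz))
        (hinj _ _ (hKI hk).2 (congrArg Prod.snd hkz))
    rwa [mem_preimage, hz]
  rw [heq]
  exact (hK.image hπ).isClosed.preimage hπ

theorem eventually_floor_eq {x : ℝ} (hx : 0 < Int.fract x) : ∀ᶠ x' in 𝓝 x, ⌊x'⌋ = ⌊x⌋ := by
  filter_upwards [Ioo_mem_nhds (Int.fract_pos.1 hx |>.lt_of_le' (Int.floor_le x))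
    (Int.lt_floor_add_one x)] with y hy
  exact Int.floor_eq_iff.2 ⟨hy.1.le, hy.2⟩

theorem smoothPeriodic2_fract {g : ℝ × ℝ → ℝ} (hg : ContDiff ℝ ∞ g) (hc : HasCompactSupport g)
    (hs : tsupport g ⊆ Ioo (0 : ℝ) 1 ×ˢ Ioo (0 : ℝ) 1) :
    SmoothPeriodic2 fun x y => g (Int.fract x, Int.fract y) := by
  refine ⟨contDiff_iff_contDiffAt.2 fun z => ?_, fun x y => by simp, fun x y => by simp⟩
  by_cases hz : (Int.fract z.1, Int.fract z.2) ∈ tsupport g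
  · have htranslate : ContDiff ℝ ∞ fun w : ℝ × ℝ => g (w.1 - ⌊z.1⌋, w.2 - ⌊z.2⌋) :=
      hg.comp (by fun_prop)
    refine htranslate.contDiffAt.congr_of_eventuallyEq ?_
    filter_upwards [continuous_fst.continuousAt.eventually (eventually_floor_eq (hs hz).1.1),
      continuous_snd.continuousAt.eventually (eventually_floor_eq (hs hz).2.1)] with w h₁ h₂
    simp only [Int.fract, h₁, h₂]
  · have hclosed := isClosed_preimage_fract hc
      (hs.trans (prod_mono Ioo_subset_Ico_self Ioo_subset_Ico_self))
    refine (contDiffAt_const (c := (0 : ℝ))).congr_of_eventuallyEq ?_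
    filter_upwards [hclosed.isOpen_compl.mem_nhds hz] with w hw
    exact image_eq_zero_of_notMem_tsupport hw

theorem cell2_eq_restrict_Ioo :
    cell2 = volume.restrict (Ioo (0 : ℝ) 1 ×ˢ Ioo (0 : ℝ) 1) := by
  rw [cell2, cell, ← restrict_Ioo_eq_restrict_Ioc, Measure.prod_restrict, Measure.volume_eq_prod]

theorem ae_cell2_eq_zero_of_integral_eq_zero {f : ℝ → ℝ → ℝ}
    (hf : Integrable (fun z : ℝ × ℝ => f z.1 z.2) cell2)
    (h : ∀ ψ, SmoothPeriodic2 ψ → ∫ x in (0 : ℝ)..1, ∫ y in (0 : ℝ)..1, f x y * ψ x y = 0) :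
    ∀ᵐ z ∂cell2, f z.1 z.2 = 0 := by
  have hU : IsOpen (Ioo (0 : ℝ) 1 ×ˢ Ioo (0 : ℝ) 1) := isOpen_Ioo.prod isOpen_Ioo
  have hloc : IntegrableOn (fun z : ℝ × ℝ => f z.1 z.2) (Ioo (0 : ℝ) 1 ×ˢ Ioo (0 : ℝ) 1) := by
    rwa [IntegrableOn, ← cell2_eq_restrict_Ioo]
  rw [cell2_eq_restrict_Ioo, ae_restrict_iff' hU.measurableSet]
  refine hU.ae_eq_zero_of_integral_contDiff_smul_eq_zero hloc.locallyIntegrableOn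
    fun g hg hc hs => ?_
  have hψ := smoothPeriodic2_fract hg hc hs
  obtain ⟨C, hC⟩ := hc.exists_bound_of_continuous hg.continuous
  have hint : Integrable (fun z : ℝ × ℝ => f z.1 z.2 * g (Int.fract z.1, Int.fract z.2)) cell2 :=
    hf.mul_bdd (c := C) hψ.1.continuous.aestronglyMeasurable (ae_of_all _ fun z => hC _)
  rw [← h _ hψ, ← integral_cell2 hint, cell2_eq_restrict_Ioo,
    ← setIntegral_eq_integral_of_forall_compl_eq_zero (s := Ioo (0 : ℝ) 1 ×ˢ Ioo (0 : ℝ) 1)]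
  · refine setIntegral_congr_fun hU.measurableSet fun z hz => ?_
    simp only [Int.fract_eq_self.2 ⟨hz.1.1.le, hz.1.2⟩, Int.fract_eq_self.2 ⟨hz.2.1.le, hz.2.2⟩,
      smul_eq_mul, mul_comm]
  · intro z hz
    rw [image_eq_zero_of_notMem_tsupport fun hz' => hz (hs hz'), zero_smul]

theorem ae_cell_eq_zero_of_integral_eq_zero {f : ℝ → ℝ} (hf : Integrable f cell)
    (h : ∀ ψ, SmoothPeriodic ψ → ∫ x in (0 : ℝ)..1, f x * ψ x = 0) : ∀ᵐ x ∂cell, f x = 0 := by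
  have hzero : ∀ᵐ z ∂cell2, f z.2 = 0 :=
    ae_cell2_eq_zero_of_integral_eq_zero (f := fun _ y => f y) (hf.comp_snd cell) fun ψ hψ => by
      have hslice : ∀ x, ∫ y in (0 : ℝ)..1, f y * ψ x y = 0 := fun x =>
        h _ ⟨hψ.1.comp (by fun_prop : ContDiff ℝ ∞ fun y : ℝ => (x, y)), hψ.2.2 x⟩
      simp only [hslice, intervalIntegral.integral_zero]
  exact (Measure.ae_ae_of_ae_prod hzero).exists.choose_spec

theorem WeakTwoScale.ae_eq {q : ℝ≥0∞} (hq : 1 ≤ q) {ε : ℕ → ℝ} {w : ℕ → ℝ → ℝ} {f g : ℝ → ℝ → ℝ}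
    (hf : WeakTwoScale q ε w f) (hg : WeakTwoScale q ε w g) :
    ∀ᵐ z ∂cell2, f z.1 z.2 = g z.1 z.2 := by
  have hfi := hf.2.1.integrable hq
  have hgi := hg.2.1.integrable hq
  refine (ae_cell2_eq_zero_of_integral_eq_zero (f := fun x y => f x y - g x y) (hfi.sub hgi)
    fun ψ hψ => ?_).mono fun z hz => sub_eq_zero.1 hz
  have hψ_mem := memLp_cell2_of_continuous hψ.1.continuous ⊤
  have hfψ : Integrable (fun z : ℝ × ℝ => f z.1 z.2 * ψ z.1 z.2) cell2 :=
    hfi.mul_of_top_left hψ_mem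
  have hgψ : Integrable (fun z : ℝ × ℝ => g z.1 z.2 * ψ z.1 z.2) cell2 :=
    hgi.mul_of_top_left hψ_mem
  have hlimit := tendsto_nhds_unique (hf.2.2 ψ hψ) (hg.2.2 ψ hψ)
  simp only [sub_mul]
  rw [← integral_cell2 (f := fun x y => f x y * ψ x y - g x y * ψ x y) (hfψ.sub hgψ),
    integral_sub hfψ hgψ, integral_cell2 (f := fun x y => f x y * ψ x y) hfψ,
    integral_cell2 (f := fun x y => g x y * ψ x y) hgψ, hlimit, sub_self]

theorem WeakTwoScale.congr_ae {q : ℝ≥0∞} {ε : ℕ → ℝ} {w : ℕ → ℝ → ℝ} {f g : ℝ → ℝ → ℝ}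
    (hf : WeakTwoScale q ε w f) (hfg : ∀ᵐ z ∂cell2, f z.1 z.2 = g z.1 z.2) :
    WeakTwoScale q ε w g := by
  refine ⟨hf.1, hf.2.1.ae_eq hfg, fun ψ hψ => ?_⟩
  rw [← intervalIntegral_intervalIntegral_congr_cell2 (f := fun x y => f x y * ψ x y)
    (hfg.mono fun z hz => by rw [hz]) (right_mem_Icc.2 zero_le_one)]
  exact hf.2.2 ψ hψ

theorem StrongTwoScale.congr_ae {q : ℝ≥0∞} {ε : ℕ → ℝ} {w : ℕ → ℝ → ℝ} {f g : ℝ → ℝ → ℝ}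
    (hf : StrongTwoScale q ε w f) (hfg : ∀ᵐ z ∂cell2, f z.1 z.2 = g z.1 z.2) :
    StrongTwoScale q ε w g :=
  ⟨hf.1.congr_ae hfg, eLpNorm_congr_ae hfg ▸ hf.2⟩

/-! ### Periodic primitives and weak derivatives -/

theorem intervalIntegrable_iff_integrable_cell {E : Type*} [NormedAddCommGroup E] {f : ℝ → E} :
    IntervalIntegrable f volume 0 1 ↔ Integrable f cell :=
  intervalIntegrable_iff_integrableOn_Ioc_of_le zero_le_one

/-- The primitive of `g` with zero mean over `[0,1]`; it turns derivatives back into the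
normalized value functions of the game. -/
noncomputable def zeroMeanPrimitive (g : ℝ → ℝ) (x : ℝ) : ℝ :=
  (∫ s in (0 : ℝ)..x, g s) - ∫ z in (0 : ℝ)..1, ∫ s in (0 : ℝ)..z, g s

section ZeroMeanPrimitive

variable {g : ℝ → ℝ}

theorem hasDerivAt_zeroMeanPrimitive (hg : Continuous g) (x : ℝ) :
    HasDerivAt (zeroMeanPrimitive g) (g x) x :=
  (hg.integral_hasStrictDerivAt 0 x).hasDerivAt.sub_const _

theorem continuous_zeroMeanPrimitive (hg : Continuous g) : Continuous (zeroMeanPrimitive g) :=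
  continuous_iff_continuousAt.2 fun x => (hasDerivAt_zeroMeanPrimitive hg x).continuousAt

theorem zeroMeanPrimitive_sub_zeroMeanPrimitive (hg : Continuous g) (x y : ℝ) :
    zeroMeanPrimitive g y - zeroMeanPrimitive g x = ∫ s in x..y, g s := by
  rw [zeroMeanPrimitive, zeroMeanPrimitive, sub_sub_sub_cancel_right,
    intervalIntegral.integral_interval_sub_left (hg.intervalIntegrable _ _)
      (hg.intervalIntegrable _ _)]

theorem integral_zeroMeanPrimitive (hg : Continuous g) :
    ∫ x in (0 : ℝ)..1, zeroMeanPrimitive g x = 0 := by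
  unfold zeroMeanPrimitive
  rw [intervalIntegral.integral_sub ((intervalIntegral.continuous_primitive
    (fun _ _ => hg.intervalIntegrable _ _) 0).intervalIntegrable _ _) intervalIntegrable_const]
  simp

theorem zeroMeanPrimitive_one (hg : Continuous g) (h0 : ∫ s in (0 : ℝ)..1, g s = 0) :
    zeroMeanPrimitive g 1 = zeroMeanPrimitive g 0 := by
  rw [← sub_eq_zero, zeroMeanPrimitive_sub_zeroMeanPrimitive hg, h0]

theorem periodic_zeroMeanPrimitive (hg : Continuous g) (hper : Function.Periodic g 1)
    (h0 : ∫ s in (0 : ℝ)..1, g s = 0) : Function.Periodic (zeroMeanPrimitive g) 1 := fun x => by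
  rw [← sub_eq_zero, zeroMeanPrimitive_sub_zeroMeanPrimitive hg,
    hper.intervalIntegral_add_eq x 0, zero_add, h0]

theorem smoothPeriodic_zeroMeanPrimitive (hg : SmoothPeriodic g)
    (h0 : ∫ s in (0 : ℝ)..1, g s = 0) : SmoothPeriodic (zeroMeanPrimitive g) := by
  have hderiv := hasDerivAt_zeroMeanPrimitive hg.1.continuous
  refine ⟨contDiff_infty_iff_deriv.2 ⟨fun x => (hderiv x).differentiableAt, ?_⟩,
    periodic_zeroMeanPrimitive hg.1.continuous hg.2 h0⟩
  rw [funext fun x => (hderiv x).deriv]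
  exact hg.1

theorem zeroMeanPrimitive_sub_const (hg : Continuous g) (c x : ℝ) :
    zeroMeanPrimitive (fun s => g s - c) x = zeroMeanPrimitive g x - c * x + c / 2 := by
  have hprim : ∀ z, ∫ s in (0 : ℝ)..z, (g s - c) = (∫ s in (0 : ℝ)..z, g s) - c * z := fun z => by
    rw [intervalIntegral.integral_sub (hg.intervalIntegrable _ _) intervalIntegrable_const]
    simp [mul_comm]
  simp only [zeroMeanPrimitive, hprim]
  rw [intervalIntegral.integral_sub ((intervalIntegral.continuous_primitive
    (fun _ _ => hg.intervalIntegrable _ _) 0).intervalIntegrable _ _)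
    ((by fun_prop : Continuous fun z : ℝ => c * z).intervalIntegrable _ _),
    intervalIntegral.integral_const_mul, integral_id]
  ring

theorem eq_zeroMeanPrimitive_deriv {u : ℝ → ℝ} (hu : ContDiff ℝ 1 u)
    (h0 : ∫ x in (0 : ℝ)..1, u x = 0) : u = zeroMeanPrimitive (deriv u) := by
  have hprim : ∀ z, ∫ s in (0 : ℝ)..z, deriv u s = u z - u 0 := fun z =>
    intervalIntegral.integral_deriv_eq_sub (fun y _ => hu.differentiable one_ne_zero y)
      ((hu.continuous_deriv le_rfl).intervalIntegrable _ _)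
  funext x
  simp only [zeroMeanPrimitive, hprim]
  rw [intervalIntegral.integral_sub (hu.continuous.intervalIntegrable _ _)
    intervalIntegrable_const, h0]
  simp

theorem tendstoUniformlyOn_zeroMeanPrimitive {ι : Type*} {l : Filter ι} [l.IsCountablyGenerated]
    {w : ι → ℝ → ℝ} {w₀ : ℝ → ℝ} (hw : ∀ i, Continuous (w i))
    (h : TendstoUniformlyOn (fun i t => ∫ x in (0 : ℝ)..t, w i x)
      (fun t => ∫ x in (0 : ℝ)..t, w₀ x) l (Icc 0 1)) :
    TendstoUniformlyOn (fun i => zeroMeanPrimitive (w i)) (zeroMeanPrimitive w₀) l (Icc 0 1) := by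
  have hmean := TendstoUniformlyOn.tendsto_intervalIntegral_of_continuousOn (μ := volume)
    (Eventually.of_forall fun i => (intervalIntegral.continuous_primitive
      (fun _ _ => (hw i).intervalIntegrable _ _) 0).continuousOn)
    ((uIcc_of_le (zero_le_one' ℝ)).symm ▸ h)
  exact h.sub (hmean.tendstoUniformlyOn_const _)

end ZeroMeanPrimitive

theorem isWeakDeriv_of_hasDerivAt {v dv : ℝ → ℝ} (hv : ∀ x, HasDerivAt v (dv x) x)
    (hdv : Continuous dv) (h01 : v 1 = v 0) : IsWeakDeriv v dv := by
  intro φ hφ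
  have hφ' : ∀ x, HasDerivAt φ (deriv φ x) x := fun x =>
    (hφ.1.differentiable (by simp) x).hasDerivAt
  rw [intervalIntegral.integral_mul_deriv_eq_deriv_mul (fun x _ => hv x) (fun x _ => hφ' x)
    (hdv.intervalIntegrable _ _) ((hφ.1.continuous_deriv (by simp)).intervalIntegrable _ _),
    h01, ← zero_add (1 : ℝ), hφ.2 0, sub_self, zero_sub]

theorem isWeakDeriv_zeroMeanPrimitive {g : ℝ → ℝ} (hg : Continuous g)
    (h0 : ∫ s in (0 : ℝ)..1, g s = 0) : IsWeakDeriv (zeroMeanPrimitive g) g :=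
  isWeakDeriv_of_hasDerivAt (hasDerivAt_zeroMeanPrimitive hg) hg (zeroMeanPrimitive_one hg h0)

namespace IsWeakDeriv

variable {f df : ℝ → ℝ}

theorem integral_eq_zero (h : IsWeakDeriv f df) : ∫ x in (0 : ℝ)..1, df x = 0 := by
  simpa using (h (fun _ => 1) ⟨contDiff_const, fun _ => rfl⟩).symm

theorem congr_ae (h : IsWeakDeriv f df) {dg : ℝ → ℝ} (hdf : df =ᵐ[cell] dg) :
    IsWeakDeriv f dg := fun φ hφ => by
  rw [h φ hφ, intervalIntegral_congr_cell (hdf.mono fun x hx => by rw [hx])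
    (left_mem_Icc.2 zero_le_one) (right_mem_Icc.2 zero_le_one)]

theorem sub (hf : IsWeakDeriv f df) {g dg : ℝ → ℝ} (hg : IsWeakDeriv g dg)
    (hfi : Integrable f cell) (hdfi : Integrable df cell) (hgi : Integrable g cell)
    (hdgi : Integrable dg cell) :
    IsWeakDeriv (fun x => f x - g x) (fun x => df x - dg x) := fun φ hφ => by
  have hmul : ∀ {k ψ : ℝ → ℝ}, Integrable k cell → Continuous ψ →
      IntervalIntegrable (fun x => k x * ψ x) volume 0 1 := fun hk hψ =>
    (intervalIntegrable_iff_integrable_cell.2 hk).mul_continuousOn hψ.continuousOn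
  have hφ' := hφ.1.continuous_deriv (by simp)
  simp only [sub_mul]
  rw [intervalIntegral.integral_sub (hmul hfi hφ') (hmul hgi hφ'),
    intervalIntegral.integral_sub (hmul hdfi hφ.1.continuous) (hmul hdgi hφ.1.continuous),
    hf φ hφ, hg φ hφ]
  ring

/-- A smooth periodic function of zero mean is the derivative of a test function. -/
theorem integral_mul_eq_zero (h : IsWeakDeriv f 0) {ψ : ℝ → ℝ} (hψ : SmoothPeriodic ψ)
    (h0 : ∫ x in (0 : ℝ)..1, ψ x = 0) : ∫ x in (0 : ℝ)..1, f x * ψ x = 0 := by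
  simpa [(hasDerivAt_zeroMeanPrimitive hψ.1.continuous _).deriv]
    using h _ (smoothPeriodic_zeroMeanPrimitive hψ h0)

theorem ae_eq_integral (h : IsWeakDeriv f 0) (hf : Integrable f cell) :
    ∀ᵐ x ∂cell, f x = ∫ y in (0 : ℝ)..1, f y := by
  refine (ae_cell_eq_zero_of_integral_eq_zero (f := fun x => f x - ∫ y in (0 : ℝ)..1, f y)
    (hf.sub (integrable_const _)) fun ψ hψ => ?_).mono fun x hx => sub_eq_zero.1 hx
  have hψi := hψ.1.continuous.intervalIntegrable (μ := volume) 0 1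
  have hfi := intervalIntegrable_iff_integrable_cell.2 hf
  have hfψ := hfi.mul_continuousOn hψ.1.continuous.continuousOn
  have hcentered := h.integral_mul_eq_zero (ψ := fun x => ψ x - ∫ y in (0 : ℝ)..1, ψ y)
    ⟨hψ.1.sub contDiff_const, fun x => by simp only [hψ.2 x]⟩
    (by rw [intervalIntegral.integral_sub hψi intervalIntegrable_const]; simp)
  simp only [mul_sub] at hcentered
  rw [intervalIntegral.integral_sub hfψ (hfi.mul_const _), intervalIntegral.integral_mul_const]
    at hcentered
  simp only [sub_mul]
  rw [intervalIntegral.integral_sub hfψ (hψi.const_mul _), intervalIntegral.integral_const_mul,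
    hcentered]

theorem ae_eq_integral_add_zeroMeanPrimitive (h : IsWeakDeriv f df) (hf : Integrable f cell)
    (hdf : Continuous df) :
    ∀ᵐ x ∂cell, f x = (∫ y in (0 : ℝ)..1, f y) + zeroMeanPrimitive df x := by
  have hint : ∀ {g : ℝ → ℝ}, Continuous g → Integrable g cell := fun hg =>
    (memLp_cell_of_continuous hg 1).integrable le_rfl
  have hprim := continuous_zeroMeanPrimitive hdf
  have hdiff := h.sub (isWeakDeriv_zeroMeanPrimitive hdf h.integral_eq_zero) hf (hint hdf)
    (hint hprim) (hint hdf)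
  simp only [sub_self] at hdiff
  filter_upwards [hdiff.ae_eq_integral (hf.sub (hint hprim))] with x hx
  rw [intervalIntegral.integral_sub (intervalIntegrable_iff_integrable_cell.2 hf)
    (hprim.intervalIntegrable _ _), integral_zeroMeanPrimitive hdf, sub_zero] at hx
  linarith

theorem exists_periodic_representative (h : IsWeakDeriv f df) (hf : Integrable f cell)
    {g : ℝ → ℝ} (hg : Continuous g) (hper : Function.Periodic g 1) {c : ℝ}
    (hdf : ∀ᵐ x ∂cell, df x = g x - c) :
    ∃ v : ℝ → ℝ, Continuous v ∧ Function.Periodic v 1 ∧ (∀ᵐ x ∂cell, f x = v x) ∧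
      ∀ x, v x = v 0 + (∫ s in (0 : ℝ)..x, g s) - x * ∫ s in (0 : ℝ)..1, g s := by
  have h' : IsWeakDeriv f fun x => g x - c := h.congr_ae hdf
  have hgc : Continuous fun x => g x - c := hg.sub continuous_const
  have hprim : ∀ x, ∫ s in (0 : ℝ)..x, (g s - c) = (∫ s in (0 : ℝ)..x, g s) - x * c := fun x => by
    rw [intervalIntegral.integral_sub (hg.intervalIntegrable _ _) intervalIntegrable_const]
    simp
  have hc : ∫ s in (0 : ℝ)..1, g s = c := by
    have := hprim 1
    rw [h'.integral_eq_zero] at this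
    linarith
  refine ⟨fun x => (∫ y in (0 : ℝ)..1, f y) + zeroMeanPrimitive (fun s => g s - c) x,
    continuous_const.add (continuous_zeroMeanPrimitive hgc), fun x => ?_,
    h'.ae_eq_integral_add_zeroMeanPrimitive hf hgc, fun x => ?_⟩
  · have hgcper : Function.Periodic (fun s => g s - c) 1 := fun y => by simp only [hper y]
    simp only [periodic_zeroMeanPrimitive hgc hgcper h'.integral_eq_zero x]
  · have := zeroMeanPrimitive_sub_zeroMeanPrimitive hgc 0 x
    rw [hprim] at this
    rw [hc]
    linarith

end IsWeakDeriv

theorem exists_holderWith_of_periodic {f : ℝ → ℝ} (hf : ContDiff ℝ 1 f)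
    (hper : Function.Periodic f 1) (hper' : Function.Periodic (deriv f) 1) :
    ∃ α : ℝ≥0, 0 < α ∧ α < 1 ∧ ∃ C : ℝ≥0, HolderWith C α f := by
  obtain ⟨B, hB⟩ := Metric.isBounded_iff_nndist.1 (hper.isBounded_of_continuous one_ne_zero
    hf.continuous)
  obtain ⟨L, hL⟩ := (hper'.isBounded_of_continuous one_ne_zero
    (hf.continuous_deriv le_rfl)).exists_norm_le
  have hzero : HolderWith B 0 f := fun x y => by
    rw [NNReal.coe_zero, ENNReal.rpow_zero, mul_one, edist_nndist]
    exact ENNReal.coe_le_coe.2 (hB (mem_range_self x) (mem_range_self y))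
  have hone : HolderWith L.toNNReal 1 f :=
    (lipschitzWith_of_nnnorm_deriv_le (hf.differentiable one_ne_zero) fun x =>
      NNReal.le_toNNReal_of_coe_le (hL _ (mem_range_self x))).holderWith
  exact ⟨1 / 2, by norm_num, NNReal.half_lt_self one_ne_zero, _,
    hzero.of_le_of_le hone (by norm_num) (NNReal.half_lt_self one_ne_zero).le⟩

theorem tendsto_eLpNorm_top_sub_of_tendstoUniformlyOn {α ι E : Type*} [MeasurableSpace α]
    {μ : Measure α} [NormedAddCommGroup E] {l : Filter ι} {f : ι → α → E} {g : α → E} {s : Set α}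
    (hs : ∀ᵐ x ∂μ, x ∈ s) (h : TendstoUniformlyOn f g l s) :
    Tendsto (fun i => eLpNorm (fun x => f i x - g x) ⊤ μ) l (𝓝 0) := by
  rw [ENNReal.tendsto_nhds_zero]
  intro η hη
  obtain ⟨δ, hδ, hδη⟩ := ENNReal.lt_iff_exists_nnreal_btwn.1 hη
  filter_upwards [Metric.tendstoUniformlyOn_iff.1 h δ (by simpa using hδ)] with i hi
  rw [eLpNorm_exponent_top]
  refine (eLpNormEssSup_le_of_ae_nnnorm_bound ?_).trans hδη.le
  filter_upwards [hs] with x hx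
  rw [← NNReal.coe_le_coe, coe_nnnorm, ← dist_eq_norm, dist_comm]
  exact (hi x hx).le

/-! ### The inverse of `F` -/

theorem Finv_pos (j s : ℝ) : 0 < Finv j s :=
  Function.invFunOn_mem ((F_bijOn j).surjOn (mem_univ s))

theorem F_Finv (j s : ℝ) : F j (Finv j s) = s :=
  Function.invFunOn_eq ((F_bijOn j).surjOn (mem_univ s))

theorem Finv_F (j : ℝ) {t : ℝ} (ht : 0 < t) : Finv j (F j t) = t :=
  (F_bijOn j).injOn.leftInvOn_invFunOn ht

theorem abs_log_sub_log_le_abs_F_sub (j : ℝ) {a b : ℝ} (ha : 0 < a) (hb : 0 < b) :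
    |Real.log a - Real.log b| ≤ |F j a - F j b| := by
  wlog hab : a ≤ b generalizing a b
  · rw [abs_sub_comm, abs_sub_comm (F j a)]
    exact this hb ha (le_of_not_ge hab)
  have hlog : Real.log a ≤ Real.log b := Real.log_le_log ha hab
  have hkinetic : j ^ 2 / (2 * b ^ 2) ≤ j ^ 2 / (2 * a ^ 2) := by gcongr
  rw [abs_sub_comm, abs_of_nonneg (sub_nonneg.2 hlog)]
  refine le_trans ?_ (le_abs_self _)
  unfold F
  linarith

theorem continuous_Finv : Continuous fun z : ℝ × ℝ => Finv z.1 z.2 := by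
  have hlog : Continuous fun z : ℝ × ℝ => Real.log (Finv z.1 z.2) :=
    continuous_iff_continuousAt.2 fun ⟨j, s⟩ => by
      have hbound : ∀ z : ℝ × ℝ, dist (Real.log (Finv z.1 z.2)) (Real.log (Finv j s)) ≤
          |z.2 - F z.1 (Finv j s)| := fun z => by
        simpa only [Real.dist_eq, F_Finv] using
          abs_log_sub_log_le_abs_F_sub z.1 (Finv_pos z.1 z.2) (Finv_pos j s)
      have hcont : Continuous fun z : ℝ × ℝ => |z.2 - F z.1 (Finv j s)| := by
        unfold F
        fun_prop
      have hzero : Tendsto (fun z : ℝ × ℝ => |z.2 - F z.1 (Finv j s)|) (𝓝 (j, s)) (𝓝 0) := by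
        simpa only [F_Finv, sub_self, abs_zero] using hcont.tendsto (j, s)
      exact tendsto_iff_dist_tendsto_zero.2 (squeeze_zero (fun _ => dist_nonneg) hbound hzero)
  simpa only [Real.exp_log (Finv_pos _ _)] using hlog.rexp

/-! ### Solutions at a fixed scale -/

namespace IsMFGSolution

variable {P ε H : ℝ} {V : ℝ → ℝ → ℝ} {u m : ℝ → ℝ}

theorem continuous_m (h : IsMFGSolution P V ε u m H) : Continuous m := h.smooth_m.1.continuous

theorem contDiff_one_u (h : IsMFGSolution P V ε u m H) : ContDiff ℝ 1 u :=
  h.smooth_u.1.of_le (by simp)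

theorem continuous_deriv_u (h : IsMFGSolution P V ε u m H) : Continuous (deriv u) :=
  h.contDiff_one_u.continuous_deriv le_rfl

theorem integral_deriv_u (h : IsMFGSolution P V ε u m H) :
    ∫ x in (0 : ℝ)..1, deriv u x = 0 := by
  rw [intervalIntegral.integral_deriv_eq_sub
    (fun x _ => h.contDiff_one_u.differentiable one_ne_zero x)
    (h.continuous_deriv_u.intervalIntegrable _ _), ← zero_add (1 : ℝ), h.smooth_u.2 0, sub_self]

theorem differentiable_current (h : IsMFGSolution P V ε u m H) :
    Differentiable ℝ (current P u m) :=
  (h.smooth_m.1.differentiable (by simp)).mul ((differentiable_const P).add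
    ((contDiff_infty_iff_deriv.1 h.smooth_u.1).2.differentiable (by simp)))

theorem current_eq (h : IsMFGSolution P V ε u m H) {x : ℝ} (hx : x ∈ Icc (0 : ℝ) 1) :
    current P u m x = current P u m 0 := by
  refine constant_of_derivWithin_zero h.differentiable_current.differentiableOn
    (fun y hy => ?_) x hx
  rw [(h.differentiable_current y).derivWithin
    (uniqueDiffOn_Icc_zero_one y (Ico_subset_Icc_self hy))]
  exact neg_eq_zero.1 (h.fokker_planck y (Ico_subset_Icc_self hy))

theorem deriv_u_eq (h : IsMFGSolution P V ε u m H) {x : ℝ} (hx : x ∈ Icc (0 : ℝ) 1) :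
    deriv u x = current P u m 0 / m x - P := by
  rw [← h.current_eq hx, current, mul_div_cancel_left₀ _ (h.m_pos x).ne', add_sub_cancel_left]

theorem F_m (h : IsMFGSolution P V ε u m H) {x : ℝ} (hx : x ∈ Icc (0 : ℝ) 1) :
    F (current P u m 0) (m x) = H - V x (x / ε) := by
  have hm := (h.m_pos x).ne'
  have hkinetic : (m x * (P + deriv u x)) ^ 2 / (2 * m x ^ 2) = (P + deriv u x) ^ 2 / 2 := by
    field_simp
  rw [F, ← h.current_eq hx, current, hkinetic]
  linarith [h.hamilton_jacobi x hx]

theorem m_eq_Finv (h : IsMFGSolution P V ε u m H) {x : ℝ} (hx : x ∈ Icc (0 : ℝ) 1) :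
    m x = Finv (current P u m 0) (H - V x (x / ε)) := by
  rw [← h.F_m hx, Finv_F _ (h.m_pos x)]

theorem exists_m_eq_one (h : IsMFGSolution P V ε u m H) : ∃ x ∈ Icc (0 : ℝ) 1, m x = 1 := by
  obtain ⟨c, hc, hcm⟩ := exists_eq_interval_average (zero_ne_one' ℝ)
    h.continuous_m.continuousOn (f := m)
  rw [interval_average_eq, h.mass_m] at hcm
  rw [uIoo_of_le zero_le_one] at hc
  exact ⟨c, Ioo_subset_Icc_self hc, by simpa using hcm⟩

section Bounds

variable {K : ℝ}

theorem m_le (h : IsMFGSolution P V ε u m H) (hK : ∀ x ∈ Icc (0 : ℝ) 1, ∀ y, |V x y| ≤ K)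
    (x : ℝ) : m x ≤ Real.exp (2 * K) := by
  obtain ⟨y, hy, hxy⟩ := h.smooth_m.2.exists_mem_Ico₀ one_pos x
  have hy' := Ico_subset_Icc_self hy
  obtain ⟨x₀, hx₀, hm⟩ := h.exists_m_eq_one
  have hlog := abs_log_sub_log_le_abs_F_sub (current P u m 0) (h.m_pos y) (h.m_pos x₀)
  rw [h.F_m hy', h.F_m hx₀, hm, Real.log_one, sub_zero, sub_sub_sub_cancel_left] at hlog
  rw [hxy]
  refine (Real.log_le_iff_le_exp (h.m_pos y)).1 ?_
  linarith [le_abs_self (Real.log (m y)), abs_sub (V x₀ (x₀ / ε)) (V y (y / ε)),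
    hK x₀ hx₀ (x₀ / ε), hK y hy' (y / ε)]

theorem abs_current_le (h : IsMFGSolution P V ε u m H)
    (hK : ∀ x ∈ Icc (0 : ℝ) 1, ∀ y, |V x y| ≤ K) :
    |current P u m 0| ≤ Real.exp (2 * K) * |P| := by
  obtain ⟨c, hc, hd⟩ := exists_deriv_eq_zero (f := u) zero_lt_one
    h.contDiff_one_u.continuous.continuousOn (by simpa using (h.smooth_u.2 0).symm)
  rw [← h.current_eq (Ioo_subset_Icc_self hc), current, hd, add_zero, abs_mul,
    abs_of_pos (h.m_pos c)]
  gcongr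
  exact h.m_le hK c

theorem abs_H_le (h : IsMFGSolution P V ε u m H) (hK : ∀ x ∈ Icc (0 : ℝ) 1, ∀ y, |V x y| ≤ K) :
    |H| ≤ (Real.exp (2 * K) * |P|) ^ 2 / 2 + K := by
  obtain ⟨x₀, hx₀, hm⟩ := h.exists_m_eq_one
  have hH : H = current P u m 0 ^ 2 / 2 + V x₀ (x₀ / ε) := by
    have := h.F_m hx₀
    rw [hm, F, Real.log_one] at this
    linarith
  rw [hH]
  refine (abs_add_le _ _).trans (add_le_add ?_ (hK x₀ hx₀ _))
  rw [abs_of_nonneg (by positivity), ← sq_abs]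
  gcongr
  exact h.abs_current_le hK

end Bounds

end IsMFGSolution

/-! ### The limits of a convergent sequence of solutions -/

/-- The two-scale limit of the densities, for the limits `H` and `j` of the effective constants
and of the currents. -/
noncomputable def limitDensity (V : ℝ → ℝ → ℝ) (H j x y : ℝ) : ℝ := Finv j (H - V x y)

/-- The two-scale limit of the derivatives of the value functions. -/
noncomputable def limitGradient (P : ℝ) (V : ℝ → ℝ → ℝ) (H j x y : ℝ) : ℝ :=
  j / limitDensity V H j x y - P

/-- The weak limit of the derivatives of the value functions: the cell average of
`limitGradient`. -/
noncomputable def meanGradient (P : ℝ) (V : ℝ → ℝ → ℝ) (H j x : ℝ) : ℝ :=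
  ∫ y in (0 : ℝ)..1, limitGradient P V H j x y

/-- The uniform limit of the value functions. -/
noncomputable def limitValue (P : ℝ) (V : ℝ → ℝ → ℝ) (H j : ℝ) : ℝ → ℝ :=
  zeroMeanPrimitive (meanGradient P V H j)

/-- The corrector `u₁`, normalized to have zero mean in the fast variable. -/
noncomputable def limitCorrector (P : ℝ) (V : ℝ → ℝ → ℝ) (H j x : ℝ) : ℝ → ℝ :=
  zeroMeanPrimitive fun y => limitGradient P V H j x y - meanGradient P V H j x

/-- Solutions along the scales `ε n` whose effective constants and currents converge. Both are
bounded, so every sequence of solutions has such a subsequence, and their two limits determine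
all the others. -/
structure IsConvergentSolutionSeq (P : ℝ) (V : ℝ → ℝ → ℝ) (ε : ℕ → ℝ) (us ms : ℕ → ℝ → ℝ)
    (Hs : ℕ → ℝ) (H j : ℝ) : Prop where
  isMFGSolution : ∀ n, IsMFGSolution P V (ε n) (us n) (ms n) (Hs n)
  tendsto_H : Tendsto Hs atTop (𝓝 H)
  tendsto_current : Tendsto (fun n => current P (us n) (ms n) 0) atTop (𝓝 j)

theorem exists_subseq_isConvergentSolutionSeq {P K : ℝ} {V : ℝ → ℝ → ℝ} {ε : ℕ → ℝ}
    {us ms : ℕ → ℝ → ℝ} {Hs : ℕ → ℝ} (hK : ∀ x ∈ Icc (0 : ℝ) 1, ∀ y, |V x y| ≤ K)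
    (hsol : ∀ n, IsMFGSolution P V (ε n) (us n) (ms n) (Hs n)) :
    ∃ (φ : ℕ → ℕ) (H j : ℝ), StrictMono φ ∧
      IsConvergentSolutionSeq P V (ε ∘ φ) (us ∘ φ) (ms ∘ φ) (Hs ∘ φ) H j := by
  obtain ⟨⟨H, j⟩, -, φ, hφ, hlim⟩ := (isCompact_Icc.prod isCompact_Icc).tendsto_subseq
    (x := fun n => (Hs n, current P (us n) (ms n) 0))
    fun n => ⟨abs_le.1 ((hsol n).abs_H_le hK), abs_le.1 ((hsol n).abs_current_le hK)⟩
  exact ⟨φ, H, j, hφ, fun n => hsol (φ n), (continuous_fst.tendsto _).comp hlim,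
    (continuous_snd.tendsto _).comp hlim⟩

section Potential

variable {V : ℝ → ℝ → ℝ}

theorem limitDensity_pos (V : ℝ → ℝ → ℝ) (H j x y : ℝ) : 0 < limitDensity V H j x y :=
  Finv_pos _ _

theorem continuous_limitDensity (hV : Continuous fun z : ℝ × ℝ => V z.1 z.2) (H j : ℝ) :
    Continuous fun z : ℝ × ℝ => limitDensity V H j z.1 z.2 :=
  continuous_Finv.comp (continuous_const.prodMk (continuous_const.sub hV))

theorem continuous_const_div_limitDensity (hV : Continuous fun z : ℝ × ℝ => V z.1 z.2)
    (H j c : ℝ) : Continuous fun z : ℝ × ℝ => c / limitDensity V H j z.1 z.2 :=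
  continuous_const.div (continuous_limitDensity hV H j) fun _ => (limitDensity_pos _ _ _ _ _).ne'

theorem continuous_limitGradient (hV : Continuous fun z : ℝ × ℝ => V z.1 z.2) (P H j : ℝ) :
    Continuous fun z : ℝ × ℝ => limitGradient P V H j z.1 z.2 :=
  (continuous_const_div_limitDensity hV H j j).sub continuous_const

theorem continuous_meanGradient (hV : Continuous fun z : ℝ × ℝ => V z.1 z.2) (P H j : ℝ) :
    Continuous (meanGradient P V H j) :=
  continuous_cell_mean (continuous_limitGradient hV P H j)

theorem continuous_limitValue (hV : Continuous fun z : ℝ × ℝ => V z.1 z.2) (P H j : ℝ) :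
    Continuous (limitValue P V H j) :=
  continuous_zeroMeanPrimitive (continuous_meanGradient hV P H j)

theorem periodic_meanGradient (hVx : Function.Periodic V 1) (P H j : ℝ) :
    Function.Periodic (meanGradient P V H j) 1 := fun x => by
  simp only [meanGradient, limitGradient, limitDensity, hVx x]

theorem meanGradient_eq (hV : Continuous fun z : ℝ × ℝ => V z.1 z.2) (P H j x : ℝ) :
    meanGradient P V H j x = (∫ y in (0 : ℝ)..1, j / limitDensity V H j x y) - P := by
  have hslice : Continuous fun y => j / limitDensity V H j x y :=
    (continuous_const_div_limitDensity hV H j j).comp (by fun_prop : Continuous fun y => (x, y))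
  simp only [meanGradient, limitGradient]
  rw [intervalIntegral.integral_sub (hslice.intervalIntegrable _ _) intervalIntegrable_const]
  simp

theorem limitValue_eq (hV : Continuous fun z : ℝ × ℝ => V z.1 z.2) (P H j x : ℝ) :
    limitValue P V H j x
      = (∫ s in (0 : ℝ)..x, ∫ y in (0 : ℝ)..1, j / limitDensity V H j s y) - P * x + P / 2
        - ∫ z in (0 : ℝ)..1, ∫ s in (0 : ℝ)..z, ∫ y in (0 : ℝ)..1, j / limitDensity V H j s y := by
  rw [limitValue, funext (meanGradient_eq hV P H j), zeroMeanPrimitive_sub_const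
    (continuous_cell_mean (continuous_const_div_limitDensity hV H j j)), zeroMeanPrimitive]
  ring

theorem integral_one_div_limitDensity_pos (hV : Continuous fun z : ℝ × ℝ => V z.1 z.2)
    (H j : ℝ) : 0 < ∫ x in (0 : ℝ)..1, ∫ y in (0 : ℝ)..1, 1 / limitDensity V H j x y := by
  have hc := continuous_const_div_limitDensity hV H j 1
  refine intervalIntegral.intervalIntegral_pos_of_pos
    ((continuous_cell_mean hc).intervalIntegrable _ _) (fun x => ?_) zero_lt_one
  exact intervalIntegral.intervalIntegral_pos_of_pos
    ((hc.comp (by fun_prop : Continuous fun y : ℝ => (x, y))).intervalIntegrable _ _)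
    (fun y => one_div_pos.2 (limitDensity_pos V H j x y)) zero_lt_one

theorem memLqW1qModConst_limitCorrector (hV : Continuous fun z : ℝ × ℝ => V z.1 z.2)
    (P H j : ℝ) (q : ℝ≥0∞) :
    MemLqW1qModConst q (limitCorrector P V H j)
      fun x y => limitGradient P V H j x y - meanGradient P V H j x := by
  have hcont : Continuous fun z : ℝ × ℝ =>
      limitGradient P V H j z.1 z.2 - meanGradient P V H j z.1 :=
    (continuous_limitGradient hV P H j).sub ((continuous_meanGradient hV P H j).comp continuous_fst)
  have hslice : ∀ x, Continuous fun y => limitGradient P V H j x y - meanGradient P V H j x :=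
    fun x => hcont.comp (by fun_prop : Continuous fun y : ℝ => (x, y))
  refine ⟨⟨fun x => limitCorrector P V H j x 0, memLp_cell2_of_continuous ?_ q⟩,
    memLp_cell2_of_continuous hcont q, ae_of_all _ fun x =>
      isWeakDeriv_zeroMeanPrimitive (hslice x) ?_⟩
  · simp only [limitCorrector, zeroMeanPrimitive_sub_zeroMeanPrimitive (hslice _)]
    exact intervalIntegral.continuous_parametric_intervalIntegral_of_continuous (a₀ := 0)
      (f := fun (z : ℝ × ℝ) s => limitGradient P V H j z.1 s - meanGradient P V H j z.1)
      (hcont.comp (by fun_prop : Continuous fun p : (ℝ × ℝ) × ℝ => (p.1.1, p.2))) continuous_snd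
  · have hgrad : Continuous fun y => limitGradient P V H j x y :=
      (continuous_limitGradient hV P H j).comp (by fun_prop : Continuous fun y : ℝ => (x, y))
    rw [intervalIntegral.integral_sub (hgrad.intervalIntegrable _ _) intervalIntegrable_const]
    simp [meanGradient]

end Potential

namespace IsConvergentSolutionSeq

variable {P : ℝ} {V : ℝ → ℝ → ℝ} {ε : ℕ → ℝ} {us ms : ℕ → ℝ → ℝ} {Hs : ℕ → ℝ} {H j : ℝ}

theorem isAsymptoticProfile_data (h : IsConvergentSolutionSeq P V ε us ms Hs H j)
    (hV : Continuous fun z : ℝ × ℝ => V z.1 z.2) (hVy : ∀ x, Function.Periodic (V x) 1) :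
    IsAsymptoticProfile ε (fun n x => (current P (us n) (ms n) 0, Hs n - V x (x / ε n)))
      (fun x y => (j, H - V x y)) :=
  (IsAsymptoticProfile.const h.tendsto_current ε).prodMk <|
    ((IsAsymptoticProfile.const h.tendsto_H ε).prodMk
      (IsAsymptoticProfile.oscillating hV hVy ε)).comp continuous_sub

theorem isAsymptoticProfile_density (h : IsConvergentSolutionSeq P V ε us ms Hs H j)
    (hV : Continuous fun z : ℝ × ℝ => V z.1 z.2) (hVy : ∀ x, Function.Periodic (V x) 1) :
    IsAsymptoticProfile ε ms (limitDensity V H j) :=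
  ((h.isAsymptoticProfile_data hV hVy).comp continuous_Finv).congr
    (fun n => (h.isMFGSolution n).continuous_m) fun n _ hx => (h.isMFGSolution n).m_eq_Finv hx

theorem isAsymptoticProfile_deriv (h : IsConvergentSolutionSeq P V ε us ms Hs H j)
    (hV : Continuous fun z : ℝ × ℝ => V z.1 z.2) (hVy : ∀ x, Function.Periodic (V x) 1) :
    IsAsymptoticProfile ε (fun n => deriv (us n)) (limitGradient P V H j) := by
  have hΦ : Continuous fun z : ℝ × ℝ => z.1 / Finv z.1 z.2 - P :=
    (continuous_fst.div continuous_Finv fun _ => (Finv_pos _ _).ne').sub continuous_const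
  refine ((h.isAsymptoticProfile_data hV hVy).comp hΦ).congr
    (fun n => (h.isMFGSolution n).continuous_deriv_u) fun n x hx => ?_
  rw [(h.isMFGSolution n).deriv_u_eq hx, (h.isMFGSolution n).m_eq_Finv hx]

theorem integral_limitDensity (h : IsConvergentSolutionSeq P V ε us ms Hs H j)
    (hV : Continuous fun z : ℝ × ℝ => V z.1 z.2) (hVy : ∀ x, Function.Periodic (V x) 1)
    (hε : Tendsto ε atTop (𝓝[≠] 0)) :
    ∫ x in (0 : ℝ)..1, ∫ y in (0 : ℝ)..1, limitDensity V H j x y = 1 := by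
  have hlim := (h.isAsymptoticProfile_density hV hVy).tendsto_integral hε
  simp only [(h.isMFGSolution _).mass_m] at hlim
  exact tendsto_nhds_unique hlim tendsto_const_nhds

theorem integral_meanGradient (h : IsConvergentSolutionSeq P V ε us ms Hs H j)
    (hV : Continuous fun z : ℝ × ℝ => V z.1 z.2) (hVy : ∀ x, Function.Periodic (V x) 1)
    (hε : Tendsto ε atTop (𝓝[≠] 0)) : ∫ x in (0 : ℝ)..1, meanGradient P V H j x = 0 := by
  have hlim := (h.isAsymptoticProfile_deriv hV hVy).tendsto_integral hε
  simp only [(h.isMFGSolution _).integral_deriv_u] at hlim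
  exact tendsto_nhds_unique hlim tendsto_const_nhds

theorem current_limit_eq (h : IsConvergentSolutionSeq P V ε us ms Hs H j)
    (hV : Continuous fun z : ℝ × ℝ => V z.1 z.2) (hVy : ∀ x, Function.Periodic (V x) 1)
    (hε : Tendsto ε atTop (𝓝[≠] 0)) :
    j = P / ∫ x in (0 : ℝ)..1, ∫ y in (0 : ℝ)..1, 1 / limitDensity V H j x y := by
  have hzero := h.integral_meanGradient hV hVy hε
  rw [funext (meanGradient_eq hV P H j), intervalIntegral.integral_sub
    ((continuous_cell_mean (continuous_const_div_limitDensity hV H j j)).intervalIntegrable _ _)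
    intervalIntegrable_const] at hzero
  simp only [div_eq_mul_one_div j, intervalIntegral.integral_const_mul,
    intervalIntegral.integral_const, sub_zero, one_smul] at hzero
  rw [eq_div_iff (integral_one_div_limitDensity_pos hV H j).ne']
  exact sub_eq_zero.1 hzero

theorem tendstoUniformlyOn_limitValue (h : IsConvergentSolutionSeq P V ε us ms Hs H j)
    (hV : Continuous fun z : ℝ × ℝ => V z.1 z.2) (hVy : ∀ x, Function.Periodic (V x) 1)
    (hε : Tendsto ε atTop (𝓝[≠] 0)) :
    TendstoUniformlyOn us (limitValue P V H j) atTop (Icc 0 1) := by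
  have hus : us = fun n => zeroMeanPrimitive (deriv (us n)) := funext fun n =>
    eq_zeroMeanPrimitive_deriv (h.isMFGSolution n).contDiff_one_u (h.isMFGSolution n).mean_u
  rw [hus]
  exact tendstoUniformlyOn_zeroMeanPrimitive (fun n => (h.isMFGSolution n).continuous_deriv_u)
    ((h.isAsymptoticProfile_deriv hV hVy).tendstoUniformlyOn_integral hε)

theorem tendsto_eLpNorm_top_sub_limitValue (h : IsConvergentSolutionSeq P V ε us ms Hs H j)
    (hV : Continuous fun z : ℝ × ℝ => V z.1 z.2) (hVy : ∀ x, Function.Periodic (V x) 1)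
    (hε : Tendsto ε atTop (𝓝[≠] 0)) :
    Tendsto (fun n => eLpNorm (fun x => us n x - limitValue P V H j x) ⊤ cell) atTop (𝓝 0) :=
  tendsto_eLpNorm_top_sub_of_tendstoUniformlyOn
    (ae_cell_mem.mono fun _ hx => Ioc_subset_Icc_self hx)
    (h.tendstoUniformlyOn_limitValue hV hVy hε)

theorem weakLq_limitValue (h : IsConvergentSolutionSeq P V ε us ms Hs H j)
    (hV : Continuous fun z : ℝ × ℝ => V z.1 z.2) (hVy : ∀ x, Function.Periodic (V x) 1)
    (hε : Tendsto ε atTop (𝓝[≠] 0)) (q : ℝ≥0∞) : WeakLq q us (limitValue P V H j) := by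
  simpa using (IsAsymptoticProfile.of_tendstoUniformlyOn
    (fun n => (h.isMFGSolution n).contDiff_one_u.continuous) (continuous_limitValue hV P H j)
    (h.tendstoUniformlyOn_limitValue hV hVy hε) ε).weakLq hε q

theorem memW1q_limitValue (h : IsConvergentSolutionSeq P V ε us ms Hs H j)
    (hV : Continuous fun z : ℝ × ℝ => V z.1 z.2) (hVy : ∀ x, Function.Periodic (V x) 1)
    (hε : Tendsto ε atTop (𝓝[≠] 0)) (q : ℝ≥0∞) :
    MemW1q q (limitValue P V H j) (meanGradient P V H j) :=
  ⟨memLp_cell_of_continuous (continuous_limitValue hV P H j) q,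
    memLp_cell_of_continuous (continuous_meanGradient hV P H j) q,
    isWeakDeriv_zeroMeanPrimitive (continuous_meanGradient hV P H j)
      (h.integral_meanGradient hV hVy hε)⟩

theorem periodic_limitValue (h : IsConvergentSolutionSeq P V ε us ms Hs H j)
    (hV : Continuous fun z : ℝ × ℝ => V z.1 z.2) (hVx : Function.Periodic V 1)
    (hVy : ∀ x, Function.Periodic (V x) 1) (hε : Tendsto ε atTop (𝓝[≠] 0)) :
    Function.Periodic (limitValue P V H j) 1 :=
  periodic_zeroMeanPrimitive (continuous_meanGradient hV P H j) (periodic_meanGradient hVx P H j)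
    (h.integral_meanGradient hV hVy hε)

theorem exists_holderWith_limitValue (h : IsConvergentSolutionSeq P V ε us ms Hs H j)
    (hV : Continuous fun z : ℝ × ℝ => V z.1 z.2) (hVx : Function.Periodic V 1)
    (hVy : ∀ x, Function.Periodic (V x) 1) (hε : Tendsto ε atTop (𝓝[≠] 0)) :
    ∃ α : ℝ≥0, 0 < α ∧ α < 1 ∧ ∃ C : ℝ≥0, HolderWith C α (limitValue P V H j) := by
  have hmean := continuous_meanGradient hV P H j
  have hder : deriv (limitValue P V H j) = meanGradient P V H j :=
    funext fun x => (hasDerivAt_zeroMeanPrimitive hmean x).deriv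
  refine exists_holderWith_of_periodic (contDiff_one_iff_deriv.2 ⟨fun x =>
    (hasDerivAt_zeroMeanPrimitive hmean x).differentiableAt, hder ▸ hmean⟩)
    (h.periodic_limitValue hV hVx hVy hε) (hder ▸ periodic_meanGradient hVx P H j)

theorem isHomogenizedLimit (h : IsConvergentSolutionSeq P V ε us ms Hs H j)
    (hV : Continuous fun z : ℝ × ℝ => V z.1 z.2) (hVx : Function.Periodic V 1)
    (hVy : ∀ x, Function.Periodic (V x) 1) (hε : Tendsto ε atTop (𝓝[≠] 0)) (q : ℝ≥0∞) :
    IsHomogenizedLimit P q ε us ms Hs (limitValue P V H j) (limitCorrector P V H j)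
      (limitDensity V H j) H j := by
  have hm := h.isAsymptoticProfile_density hV hVy
  have hu := h.isAsymptoticProfile_deriv hV hVy
  refine ⟨h.periodic_limitValue hV hVx hVy hε, h.exists_holderWith_limitValue hV hVx hVy hε,
    integral_zeroMeanPrimitive (continuous_meanGradient hV P H j),
    (memLp_cell2_of_continuous hm.continuous_profile 1).integrable le_rfl,
    h.integral_limitDensity hV hVy hε,
    ⟨meanGradient P V H j, fun x y => limitGradient P V H j x y - meanGradient P V H j x,
      h.memW1q_limitValue hV hVy hε q, memLqW1qModConst_limitCorrector hV P H j q,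
      h.weakLq_limitValue hV hVy hε q, hu.weakLq hε q, ?_⟩,
    h.tendsto_eLpNorm_top_sub_limitValue hV hVy hε, hm.weakTwoScale hε 1, hm.weakLq hε 1,
    h.tendsto_H, fun x hx => ?_⟩
  · simpa only [add_sub_cancel] using hu.weakTwoScale hε q
  · simpa only [(h.isMFGSolution _).current_eq hx] using h.tendsto_current

end IsConvergentSolutionSeq

/-! ### Identification of the limits -/

namespace IsHomogenizedLimit

variable {P : ℝ} {V : ℝ → ℝ → ℝ} {ε : ℕ → ℝ} {us ms : ℕ → ℝ → ℝ} {Hs : ℕ → ℝ} {H j : ℝ}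
  {q : ℝ≥0∞} {u₀ : ℝ → ℝ} {u₁ m : ℝ → ℝ → ℝ}

theorem isConvergentSolutionSeq (h : IsHomogenizedLimit P q ε us ms Hs u₀ u₁ m H j)
    (hsol : ∀ n, IsMFGSolution P V (ε n) (us n) (ms n) (Hs n)) :
    IsConvergentSolutionSeq P V ε us ms Hs H j := by
  obtain ⟨-, -, -, -, -, -, -, -, -, hH, hj⟩ := h
  exact ⟨hsol, hH, hj 0 (left_mem_Icc.2 zero_le_one)⟩

theorem density_ae_eq (h : IsHomogenizedLimit P q ε us ms Hs u₀ u₁ m H j)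
    (hV : Continuous fun z : ℝ × ℝ => V z.1 z.2) (hVy : ∀ x, Function.Periodic (V x) 1)
    (hε : Tendsto ε atTop (𝓝[≠] 0)) (hsol : ∀ n, IsMFGSolution P V (ε n) (us n) (ms n) (Hs n)) :
    ∀ᵐ z ∂cell2, m z.1 z.2 = limitDensity V H j z.1 z.2 := by
  have hm := (h.isConvergentSolutionSeq hsol).isAsymptoticProfile_density hV hVy
  obtain ⟨-, -, -, -, -, -, -, hms, -⟩ := h
  exact hms.ae_eq le_rfl (hm.weakTwoScale hε 1)

theorem const_div_density_ae_eq (h : IsHomogenizedLimit P q ε us ms Hs u₀ u₁ m H j)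
    (hV : Continuous fun z : ℝ × ℝ => V z.1 z.2) (hVy : ∀ x, Function.Periodic (V x) 1)
    (hε : Tendsto ε atTop (𝓝[≠] 0)) (hsol : ∀ n, IsMFGSolution P V (ε n) (us n) (ms n) (Hs n))
    (c : ℝ) : ∀ᵐ z ∂cell2, c / m z.1 z.2 = c / limitDensity V H j z.1 z.2 :=
  (h.density_ae_eq hV hVy hε hsol).mono fun _ hz => by rw [hz]

theorem density_ae_pos_and_eq (h : IsHomogenizedLimit P q ε us ms Hs u₀ u₁ m H j)
    (hV : Continuous fun z : ℝ × ℝ => V z.1 z.2) (hVy : ∀ x, Function.Periodic (V x) 1)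
    (hε : Tendsto ε atTop (𝓝[≠] 0)) (hsol : ∀ n, IsMFGSolution P V (ε n) (us n) (ms n) (Hs n)) :
    ∀ᵐ z ∂cell2, 0 < m z.1 z.2 ∧ m z.1 z.2 = Finv j (H - V z.1 z.2) :=
  (h.density_ae_eq hV hVy hε hsol).mono fun _ hz => ⟨hz ▸ limitDensity_pos V H j _ _, hz⟩

theorem strongTwoScale_density (h : IsHomogenizedLimit P q ε us ms Hs u₀ u₁ m H j)
    (hV : Continuous fun z : ℝ × ℝ => V z.1 z.2) (hVy : ∀ x, Function.Periodic (V x) 1)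
    (hε : Tendsto ε atTop (𝓝[≠] 0)) (hsol : ∀ n, IsMFGSolution P V (ε n) (us n) (ms n) (Hs n))
    {p : ℝ≥0∞} (hp0 : p ≠ 0) (hp : p ≠ ⊤) : StrongTwoScale p ε ms m :=
  (((h.isConvergentSolutionSeq hsol).isAsymptoticProfile_density hV hVy).strongTwoScale
    hε hp0 hp).congr_ae ((h.density_ae_eq hV hVy hε hsol).mono fun _ hz => hz.symm)

theorem integrable_one_div_density (h : IsHomogenizedLimit P q ε us ms Hs u₀ u₁ m H j)
    (hV : Continuous fun z : ℝ × ℝ => V z.1 z.2) (hVy : ∀ x, Function.Periodic (V x) 1)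
    (hε : Tendsto ε atTop (𝓝[≠] 0)) (hsol : ∀ n, IsMFGSolution P V (ε n) (us n) (ms n) (Hs n)) :
    Integrable (fun z : ℝ × ℝ => 1 / m z.1 z.2) cell2 :=
  ((memLp_cell2_of_continuous (continuous_const_div_limitDensity hV H j 1) 1).integrable
    le_rfl).congr ((h.const_div_density_ae_eq hV hVy hε hsol 1).mono fun _ hz => hz.symm)

theorem current_eq (h : IsHomogenizedLimit P q ε us ms Hs u₀ u₁ m H j)
    (hV : Continuous fun z : ℝ × ℝ => V z.1 z.2) (hVy : ∀ x, Function.Periodic (V x) 1)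
    (hε : Tendsto ε atTop (𝓝[≠] 0)) (hsol : ∀ n, IsMFGSolution P V (ε n) (us n) (ms n) (Hs n)) :
    j = P / ∫ x in (0 : ℝ)..1, ∫ y in (0 : ℝ)..1, 1 / m x y := by
  rw [intervalIntegral_intervalIntegral_congr_cell2 (f := fun x y => 1 / m x y)
    (g := fun x y => 1 / limitDensity V H j x y)
    (h.const_div_density_ae_eq hV hVy hε hsol 1) (right_mem_Icc.2 zero_le_one)]
  exact (h.isConvergentSolutionSeq hsol).current_limit_eq hV hVy hε

theorem eqOn_limitValue (h : IsHomogenizedLimit P q ε us ms Hs u₀ u₁ m H j)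
    (hV : Continuous fun z : ℝ × ℝ => V z.1 z.2) (hVy : ∀ x, Function.Periodic (V x) 1)
    (hε : Tendsto ε atTop (𝓝[≠] 0)) (hsol : ∀ n, IsMFGSolution P V (ε n) (us n) (ms n) (Hs n)) :
    EqOn u₀ (limitValue P V H j) (Icc 0 1) := by
  have hlim := (h.isConvergentSolutionSeq hsol).tendsto_eLpNorm_top_sub_limitValue hV hVy hε
  obtain ⟨-, ⟨α, hα, -, C, hC⟩, -, -, -, -, hu, -⟩ := h
  have hus : ∀ n, AEStronglyMeasurable (us n) cell := fun n =>
    (hsol n).contDiff_one_u.continuous.aestronglyMeasurable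
  have hu₀ : Continuous u₀ := hC.continuous hα
  have hvalue := continuous_limitValue hV P H j
  have hae : u₀ =ᵐ[cell] limitValue P V H j := tendstoInMeasure_ae_unique
    (tendstoInMeasure_of_tendsto_eLpNorm ENNReal.top_ne_zero hus hu₀.aestronglyMeasurable hu)
    (tendstoInMeasure_of_tendsto_eLpNorm ENNReal.top_ne_zero hus hvalue.aestronglyMeasurable hlim)
  refine Measure.eqOn_Icc_of_ae_eq volume zero_ne_one ?_ hu₀.continuousOn hvalue.continuousOn
  rwa [← restrict_Ioc_eq_restrict_Icc]

theorem value_eq (h : IsHomogenizedLimit P q ε us ms Hs u₀ u₁ m H j)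
    (hV : Continuous fun z : ℝ × ℝ => V z.1 z.2) (hVy : ∀ x, Function.Periodic (V x) 1)
    (hε : Tendsto ε atTop (𝓝[≠] 0)) (hsol : ∀ n, IsMFGSolution P V (ε n) (us n) (ms n) (Hs n))
    {x : ℝ} (hx : x ∈ Icc (0 : ℝ) 1) :
    u₀ x = (∫ s in (0 : ℝ)..x, ∫ y in (0 : ℝ)..1, j / m s y) - P * x + P / 2
      - ∫ z in (0 : ℝ)..1, ∫ s in (0 : ℝ)..z, ∫ y in (0 : ℝ)..1, j / m s y := by
  have hprim : ∀ z ∈ Icc (0 : ℝ) 1, ∫ s in (0 : ℝ)..z, ∫ y in (0 : ℝ)..1, j / m s y =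
      ∫ s in (0 : ℝ)..z, ∫ y in (0 : ℝ)..1, j / limitDensity V H j s y := fun z hz =>
    intervalIntegral_intervalIntegral_congr_cell2 (h.const_div_density_ae_eq hV hVy hε hsol j) hz
  rw [h.eqOn_limitValue hV hVy hε hsol hx, limitValue_eq hV, hprim x hx,
    intervalIntegral.integral_congr fun z hz => hprim z (uIcc_of_le (zero_le_one' ℝ) ▸ hz)]

theorem exists_corrector_representative (h : IsHomogenizedLimit P q ε us ms Hs u₀ u₁ m H j)
    (hV : Continuous fun z : ℝ × ℝ => V z.1 z.2) (hVy : ∀ x, Function.Periodic (V x) 1)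
    (hε : Tendsto ε atTop (𝓝[≠] 0)) (hsol : ∀ n, IsMFGSolution P V (ε n) (us n) (ms n) (Hs n))
    (hq : 1 ≤ q) :
    ∀ᵐ x ∂cell, ∃ v : ℝ → ℝ, Continuous v ∧ Function.Periodic v 1 ∧
      (∀ᵐ y ∂cell, u₁ x y = v y) ∧ ∀ y ∈ Icc (0 : ℝ) 1,
        v y = v 0 + (∫ s in (0 : ℝ)..y, j / m x s) - y * ∫ z in (0 : ℝ)..1, j / m x z := by
  have hgrad := (h.isConvergentSolutionSeq hsol).isAsymptoticProfile_deriv hV hVy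
  have hdensity := h.const_div_density_ae_eq hV hVy hε hsol j
  obtain ⟨-, -, -, -, -, ⟨du₀, du₁, -, ⟨⟨c, hc⟩, -, hweak⟩, -, -, hus⟩, -⟩ := h
  filter_upwards [Measure.ae_ae_of_ae_prod (hus.ae_eq hq (hgrad.weakTwoScale hε q)), hweak,
    (hc.integrable hq).prod_right_ae,
    ae_intervalIntegral_eq_of_ae_cell2 (f := fun x y => j / m x y)
      (g := fun x y => j / limitDensity V H j x y) hdensity]
    with x hdu₁ hweakx hcx hprim
  have hu₁ : Integrable (u₁ x) cell :=
    (hcx.add (integrable_const (c x))).congr (ae_of_all _ fun y => sub_add_cancel (u₁ x y) (c x))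
  have hg : Continuous fun y => j / limitDensity V H j x y :=
    (continuous_const_div_limitDensity hV H j j).comp (by fun_prop : Continuous fun y => (x, y))
  have hper : Function.Periodic (fun y => j / limitDensity V H j x y) 1 := fun y => by
    simp only [limitDensity, hVy x y]
  obtain ⟨v, hvc, hvper, hv, hveq⟩ := hweakx.exists_periodic_representative hu₁ hg hper
    (c := P + du₀ x) (hdu₁.mono fun y hy => by simp only [limitGradient] at hy; linarith)
  refine ⟨v, hvc, hvper, hv, fun y hy => ?_⟩
  rw [hprim y hy, hprim 1 (right_mem_Icc.2 zero_le_one)]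
  exact hveq y

end IsHomogenizedLimit

end PeriodicMFG

theorem mainTheorem7_general
    (P : ℝ) (V : ℝ → ℝ → ℝ) (hV : Continuous fun z : ℝ × ℝ => V z.1 z.2)
    (hVx : Function.Periodic V 1) (hVy : ∀ x, Function.Periodic (V x) 1)
    (ε : ℕ → ℝ) (hε : Tendsto ε atTop (𝓝[≠] 0))
    (us ms : ℕ → ℝ → ℝ) (Hs : ℕ → ℝ)
    (hsol : ∀ n, PeriodicMFG.IsMFGSolution P V (ε n) (us n) (ms n) (Hs n))
    (q : ℝ≥0∞) (hq : 1 ≤ q) :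
    (∃ C : ℝ, ∀ n x, |ms n x| ≤ C) ∧
    (∃ (φ : ℕ → ℕ) (u₀ : ℝ → ℝ) (u₁ m : ℝ → ℝ → ℝ) (H j : ℝ), StrictMono φ ∧
      PeriodicMFG.IsHomogenizedLimit P q (ε ∘ φ) (us ∘ φ) (ms ∘ φ) (Hs ∘ φ) u₀ u₁ m H j) ∧
    (∀ (φ : ℕ → ℕ) (u₀ : ℝ → ℝ) (u₁ m : ℝ → ℝ → ℝ) (H j : ℝ), StrictMono φ →
      PeriodicMFG.IsHomogenizedLimit P q (ε ∘ φ) (us ∘ φ) (ms ∘ φ) (Hs ∘ φ) u₀ u₁ m H j →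
      (∀ᵐ z ∂PeriodicMFG.cell2,
        0 < m z.1 z.2 ∧ m z.1 z.2 = PeriodicMFG.Finv j (H - V z.1 z.2)) ∧
      (∀ p : ℝ≥0∞, 1 ≤ p → p ≠ ⊤ → PeriodicMFG.StrongTwoScale p (ε ∘ φ) (ms ∘ φ) m) ∧
      Integrable (fun z : ℝ × ℝ => 1 / m z.1 z.2) PeriodicMFG.cell2 ∧
      j = P / (∫ x in (0 : ℝ)..1, ∫ y in (0 : ℝ)..1, 1 / m x y) ∧
      (∀ x ∈ Icc (0 : ℝ) 1,
        u₀ x = (∫ s in (0 : ℝ)..x, ∫ y in (0 : ℝ)..1, j / m s y) - P * x + P / 2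
          - ∫ z in (0 : ℝ)..1, ∫ s in (0 : ℝ)..z, ∫ y in (0 : ℝ)..1, j / m s y) ∧
      (∀ᵐ x ∂PeriodicMFG.cell, ∃ v : ℝ → ℝ, Continuous v ∧ Function.Periodic v 1 ∧
        (∀ᵐ y ∂PeriodicMFG.cell, u₁ x y = v y) ∧
        ∀ y ∈ Icc (0 : ℝ) 1,
          v y = v 0 + (∫ s in (0 : ℝ)..y, j / m x s) - y * ∫ z in (0 : ℝ)..1, j / m x z)) := by
  obtain ⟨K, hK⟩ := PeriodicMFG.exists_norm_le_of_periodic hV hVy (isCompact_Icc (a := 0) (b := 1))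
  refine ⟨⟨Real.exp (2 * K), fun n x => ?_⟩, ?_, fun φ u₀ u₁ m H j hφ hlim => ?_⟩
  · simpa only [abs_of_pos ((hsol n).m_pos x)] using (hsol n).m_le hK x
  · obtain ⟨φ, H, j, hφ, hconv⟩ := PeriodicMFG.exists_subseq_isConvergentSolutionSeq hK hsol
    exact ⟨φ, _, _, _, H, j, hφ,
      hconv.isHomogenizedLimit hV hVx hVy (hε.comp hφ.tendsto_atTop) q⟩
  · have hεφ : Tendsto (ε ∘ φ) atTop (𝓝[≠] 0) := hε.comp hφ.tendsto_atTop
    have hsolφ := fun n => hsol (φ n)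
    exact ⟨hlim.density_ae_pos_and_eq hV hVy hεφ hsolφ,
      fun p hp hp_top =>
        hlim.strongTwoScale_density hV hVy hεφ hsolφ (one_pos.trans_le hp).ne' hp_top,
      hlim.integrable_one_div_density hV hVy hεφ hsolφ,
      hlim.current_eq hV hVy hεφ hsolφ,
      fun x hx => hlim.value_eq hV hVy hεφ hsolφ hx,
      hlim.exists_corrector_representative hV hVy hεφ hsolφ hq⟩

theorem mainTheorem7
    (P : ℝ) (V : ℝ → ℝ → ℝ) (hV : PeriodicMFG.SmoothPeriodic2 V)
    (ε : ℕ → ℝ) (hε_pos : ∀ n, 0 < ε n) (hε : Tendsto ε atTop (𝓝 0))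
    (us ms : ℕ → ℝ → ℝ) (Hs : ℕ → ℝ)
    (hsol : ∀ n, PeriodicMFG.IsMFGSolution P V (ε n) (us n) (ms n) (Hs n))
    (q : ℝ≥0∞) (hq1 : 1 ≤ q) (hq : q ≠ ⊤) :
    -- uniform bound of the densities
    (∃ C : ℝ, ∀ n x, |ms n x| ≤ C) ∧
    -- limits exist along a subsequence
    (∃ (φ : ℕ → ℕ) (u₀ : ℝ → ℝ) (u₁ m : ℝ → ℝ → ℝ) (H j : ℝ), StrictMono φ ∧
      PeriodicMFG.IsHomogenizedLimit P q (ε ∘ φ) (us ∘ φ) (ms ∘ φ) (Hs ∘ φ) u₀ u₁ m H j) ∧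
    -- all such limits are given by the explicit formulas
    (∀ (φ : ℕ → ℕ) (u₀ : ℝ → ℝ) (u₁ m : ℝ → ℝ → ℝ) (H j : ℝ), StrictMono φ →
      PeriodicMFG.IsHomogenizedLimit P q (ε ∘ φ) (us ∘ φ) (ms ∘ φ) (Hs ∘ φ) u₀ u₁ m H j →
      (∀ᵐ z ∂PeriodicMFG.cell2,
        0 < m z.1 z.2 ∧ m z.1 z.2 = PeriodicMFG.Finv j (H - V z.1 z.2)) ∧
      (∀ p : ℝ≥0∞, 1 < p → p ≠ ⊤ → PeriodicMFG.StrongTwoScale p (ε ∘ φ) (ms ∘ φ) m) ∧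
      Integrable (fun z : ℝ × ℝ => 1 / m z.1 z.2) PeriodicMFG.cell2 ∧
      j = P / (∫ x in (0 : ℝ)..1, ∫ y in (0 : ℝ)..1, 1 / m x y) ∧
      (∀ x ∈ Icc (0 : ℝ) 1,
        u₀ x = (∫ s in (0 : ℝ)..x, ∫ y in (0 : ℝ)..1, j / m s y) - P * x + P / 2
          - ∫ z in (0 : ℝ)..1, ∫ s in (0 : ℝ)..z, ∫ y in (0 : ℝ)..1, j / m s y) ∧
      (∀ᵐ x ∂PeriodicMFG.cell, ∃ v : ℝ → ℝ, Continuous v ∧ Function.Periodic v 1 ∧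
        (∀ᵐ y ∂PeriodicMFG.cell, u₁ x y = v y) ∧
        ∀ y ∈ Icc (0 : ℝ) 1,
          v y = v 0 + (∫ s in (0 : ℝ)..y, j / m x s) - y * ∫ z in (0 : ℝ)..1, j / m x z)) := by
  obtain ⟨hbound, hexists, hunique⟩ := mainTheorem7_general P V hV.1.continuous
    (fun x => funext (hV.2.1 x)) hV.2.2 ε
    (tendsto_nhdsWithin_iff.2 ⟨hε, Eventually.of_forall fun n => (hε_pos n).ne'⟩)
    us ms Hs hsol q hq1
  refine ⟨hbound, hexists, fun φ u₀ u₁ m H j hφ hlim => ?_⟩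
  obtain ⟨hdensity, hstrong, hformulas⟩ := hunique φ u₀ u₁ m H j hφ hlim
  exact ⟨hdensity, fun p hp => hstrong p hp.le, hformulas⟩
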